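/- **Setting.** Equip $C(\mathbb{R}^d)$ with the $\sigma$-algebra generated by the evaluations $f\mapsto f(t)$, $t\in\mathbb{R}^d$. For a locally finite measure $\mu$ on a space $S$, a *Poisson point process* on $S$ with intensity measure $\mu$ is a random counting measure $\Pi$ such that $\Pi(A_1),\dots,\Pi(A_n)$ are independent for all pairwise disjoint measurable $A_1,\dots,A_n$, and $\Pi(A)$ is Poisson distributed with parameter $\mu(A)\in[0,\infty]$ for every measurable $A$ (for $\mu(A)=\infty$ this means $\Pi(A)=\infty$ a.s.). Let $W(\cdot)$ be a sample-continuous Gaussian random field on $\mathbb{R}^d$ with expectation $0$ and variance $\sigma^2(t)=\operatorname{Var}(W(t))$, which is intrinsically stationary, i.e. for each $h$ the field $x\mapsto W(x+h)-W(x)$ is weakly stationary. Assume $$\lim_{|t|\to\infty}\Big(W(t)-\frac{\sigma^2(t)}{2}\Big)=-\infty\quad\text{almost surely.}$$ **Lemma.** There are a finite constant $\lambda^*>0$ and a probability measure $Q$ on $C(\mathbb{R}^d)$ with the following property. Let $W_i(\cdot)$, $i\in\mathbb{N}$, be independent copies of $W(\cdot)$ with sample paths in $C(\mathbb{R}^d)$,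 and let $(X_i)_{i\in\mathbb{N}}$ be real random variables, the sequence $(X_i)_i$ being independent of the sequence $(W_i)_i$, such that $\sum_{i}\delta_{X_i}$ is a Poisson point process on $\mathbb{R}$ with intensity measure $e^{-x}\,dx$. Put $$T_i:=\inf\Big(\operatorname*{argsup}_{t\in\mathbb{R}^d}\big(W_i(t)-\tfrac{\sigma^2(t)}{2}\big)\Big),\qquad M_i:=\sup_{t\in\mathbb{R}^d}\big(W_i(t)-\tfrac{\sigma^2(t)}{2}\big),$$ $$F_i(\cdot):=W_i(\cdot+T_i)-\tfrac{\sigma^2(\cdot+T_i)}{2}-M_i,$$ where $\operatorname{argsup}$ is the set of points at which the supremum is attained and the infimum in $\mathbb{R}^d$ is taken coordinatewise. Then $\sum_{i}\delta_{(T_i,\,X_i+M_i,\,F_i)}$ is a Poisson point process on $\mathbb{R}^d\times\mathbb{R}\times C(\mathbb{R}^d)$, and its intensity measure is the product $$\lambda^*\,dt\times e^{-y}\,dy\times Q(dF).$$ -/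

import Mathlib

open MeasureTheory ProbabilityTheory Filter Topology
open scoped NNReal ENNReal

namespace BrownResnick

/-- The space `ℝ^d`. -/
abbrev Rd (d : ℕ) : Type := EuclideanSpace ℝ (Fin d)

/-- The `σ`-algebra on `C(ℝ^d)` generated by the cylinder sets
`{f | (f t₁, …, f tₘ) ∈ B}`, i.e. the smallest one that makes all evaluations measurable. -/
instance instMeasurableSpacePath (d : ℕ) : MeasurableSpace C(Rd d, ℝ) :=
  ⨆ t : Rd d, MeasurableSpace.comap (fun f : C(Rd d, ℝ) => f t) inferInstance

/-- Evaluation at a point is measurable on `C(ℝ^d)`. -/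
theorem measurable_eval {d : ℕ} (t : Rd d) : Measurable (fun f : C(Rd d, ℝ) => f t) :=
  Measurable.mono (comap_measurable _) (le_iSup_iff.2 fun _ hb => hb t) le_rfl

section Fields

variable {d : ℕ} {Ω : Type*} [MeasurableSpace Ω]

/-- Weak stationarity of a square-integrable random field: the expectation of `Z t` and the
covariance of `Z (x + t)` and `Z t` do not depend on `t`. -/
def IsWeaklyStationary (Z : Rd d → Ω → ℝ) (P : Measure Ω) : Prop :=
  (∀ t, MemLp (Z t) 2 P) ∧
  (∀ s t, ∫ ω, Z s ω ∂P = ∫ ω, Z t ω ∂P) ∧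
  (∀ x s t, cov[Z (x + s), Z s; P] = cov[Z (x + t), Z t; P])

/-- Intrinsic stationarity: every increment field `x ↦ Z (x + h) - Z x` is weakly stationary. -/
def IsIntrinsicallyStationary (Z : Rd d → Ω → ℝ) (P : Measure Ω) : Prop :=
  ∀ h : Rd d, IsWeaklyStationary (fun x ω => Z (x + h) ω - Z x ω) P

/-- A sample-continuous, intrinsically stationary, centred Gaussian random field on `ℝ^d`,
as a random element of `C(ℝ^d)`. -/
structure IsCentredGaussianField (W : Ω → C(Rd d, ℝ)) (P : Measure Ω) : Prop where
  aemeasurable : AEMeasurable W P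
  gaussian : IsGaussianProcess (fun (t : Rd d) ω => W ω t) P
  mean_zero : ∀ t : Rd d, ∫ ω, W ω t ∂P = 0
  stationary : IsIntrinsicallyStationary (fun (t : Rd d) ω => W ω t) P

/-- The variance function of a sample-continuous centred Gaussian field is continuous. -/
theorem IsCentredGaussianField.continuous_variance {W : Ω → C(Rd d, ℝ)} {P : Measure Ω}
    [IsProbabilityMeasure P] (hW : IsCentredGaussianField W P) :
    Continuous (fun t : Rd d => Var[fun ω => W ω t; P]) := by
  have hm : ∀ t : Rd d, AEMeasurable (fun ω => W ω t) P := fun t =>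
    (measurable_eval t).comp_aemeasurable hW.aemeasurable
  have hc : Continuous (fun t : Rd d => ∫ ω, Complex.exp ((W ω t : ℂ) * Complex.I) ∂P) := by
    refine continuous_of_dominated (bound := fun _ => (1 : ℝ)) (fun t => ?_) (fun t => ?_)
      (integrable_const _) ?_
    · exact ((by fun_prop : Continuous fun x : ℝ =>
        Complex.exp ((x : ℂ) * Complex.I)).measurable.comp_aemeasurable (hm t)).aestronglyMeasurable
    · exact Eventually.of_forall fun ω => (Complex.norm_exp_ofReal_mul_I _).le
    · exact Eventually.of_forall fun ω => by fun_prop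
  have hv : ∀ t : Rd d, ‖∫ ω, Complex.exp ((W ω t : ℂ) * Complex.I) ∂P‖
      = Real.exp (-(Var[fun ω => W ω t; P] / 2)) := by
    intro t
    have h1 : (∫ ω, Complex.exp ((W ω t : ℂ) * Complex.I) ∂P)
        = charFun (P.map (fun ω => W ω t)) 1 := by
      rw [charFun_apply_real, integral_map (hm t) (by fun_prop)]
      simp
    have h2 := (hW.gaussian.hasGaussianLaw_eval t).map_eq_gaussianReal
    rw [h1, h2, charFun_gaussianReal, hW.mean_zero t, Complex.norm_exp]
    simp [variance_nonneg]
  have he : (fun t : Rd d => Var[fun ω => W ω t; P])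
      = fun t => -2 * Real.log ‖∫ ω, Complex.exp ((W ω t : ℂ) * Complex.I) ∂P‖ := by
    funext t
    rw [hv t, Real.log_exp]
    ring
  rw [he]
  refine continuous_const.mul (hc.norm.log fun t => ?_)
  rw [hv t]
  exact (Real.exp_pos _).ne'

/-- The variance function `σ²(t) = Var (W t)`, as a continuous function on `ℝ^d`. -/
noncomputable def IsCentredGaussianField.sigmaSq {W : Ω → C(Rd d, ℝ)} {P : Measure Ω}
    [IsProbabilityMeasure P] (hW : IsCentredGaussianField W P) : C(Rd d, ℝ) :=
  ⟨fun t => Var[fun ω => W ω t; P], hW.continuous_variance⟩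

end Fields

section Paths

variable {d : ℕ}

/-- The path `t ↦ w t - s t / 2`. -/
noncomputable def driftedPath (s w : C(Rd d, ℝ)) : C(Rd d, ℝ) :=
  ⟨fun t => w t - s t / 2, by fun_prop⟩

/-- The set of points at which `ξ` attains its supremum over `ℝ^d`. -/
def argsup (ξ : C(Rd d, ℝ)) : Set (Rd d) := {t | ∀ s, ξ s ≤ ξ t}

/-- `T(ξ) = inf (argsup ξ)`, the infimum in `ℝ^d` being taken coordinate by coordinate. -/
noncomputable def argsupInf (ξ : C(Rd d, ℝ)) : Rd d :=
  WithLp.toLp 2 (fun j => sInf ((fun t : Rd d => t j) '' argsup ξ))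

/-- `M(ξ) = sup_t ξ t`. -/
noncomputable def pathSup (ξ : C(Rd d, ℝ)) : ℝ := ⨆ t : Rd d, ξ t

/-- `F(ξ) = ξ (· + T(ξ)) - M(ξ)`. -/
noncomputable def recentred (ξ : C(Rd d, ℝ)) : C(Rd d, ℝ) :=
  ⟨fun t => ξ (t + argsupInf ξ) - pathSup ξ, by fun_prop⟩

end Paths

section Poisson

/-- The Poisson distribution with parameter `r ∈ [0, ∞]`, as a law on `[0, ∞]`; for `r = ∞` it is
the point mass at `∞`. -/
noncomputable def poissonLaw (r : ℝ≥0∞) : Measure ℝ≥0∞ :=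
  if r = ∞ then Measure.dirac ∞
  else (poissonMeasure r.toNNReal).map (fun n : ℕ => (n : ℝ≥0∞))

/-- `N` is a Poisson point process on `S` with (locally finite) intensity measure `μ`: a random
counting measure whose values on disjoint measurable sets are independent and whose value on each
measurable set `A` is Poisson distributed with parameter `μ A`. -/
structure IsPoissonPointProcess {Ω S : Type*} [MeasurableSpace Ω] [TopologicalSpace S]
    [MeasurableSpace S] (N : Ω → Measure S) (μ : Measure S) (P : Measure Ω) : Prop where
  locallyFinite : IsLocallyFiniteMeasure μ
  aemeasurable : AEMeasurable N P
  counting : ∀ ω, ∀ A, MeasurableSet A → ∃ k : ℕ∞, N ω A = (k : ℝ≥0∞)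
  indep : ∀ (n : ℕ) (A : Fin n → Set S), (∀ i, MeasurableSet (A i)) →
    Pairwise (fun i j => Disjoint (A i) (A j)) → iIndepFun (fun i ω => N ω (A i)) P
  law : ∀ A, MeasurableSet A → P.map (fun ω => N ω A) = poissonLaw (μ A)

/-- The point process `∑ᵢ δ_{Yᵢ}`. -/
noncomputable def pointSum {Ω S : Type*} [MeasurableSpace S] (Y : ℕ → Ω → S) (ω : Ω) : Measure S :=
  Measure.sum (fun i => Measure.dirac (Y i ω))

/-- The measure `e^{-x} dx` on `ℝ`. -/
noncomputable def expIntensity : Measure ℝ :=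
  volume.withDensity (fun x => ENNReal.ofReal (Real.exp (-x)))

end Poisson

end BrownResnick

open BrownResnick

/-! Attach to each point `X_i` the path `W_i`. The pairs form a Poisson process with intensity
`e^{-x} dx × law(W)`, and almost surely the triples are its image under a measurable map
(`IsPoissonPointProcess.pointSum_marked`, proved by Laplace functionals). So only the image of the
intensity has to be computed. Integrating over `x` first, the shift by `M` multiplies `e^{-y} dy` by
`e^M` (`map_markMap_eq_prod`). The height splits off, and what remains is the measure `E[e^M; (T, F)
∈ ·]` on positions and shapes.

Write `ξ = W - σ²/2`. For weights with `∑ b_i = 1`, the moment `E exp(∑ b_i ξ(t_i))` depends only on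
the differences `t_i - t_j` (`lintegral_exp_sum`). Hence the law of `ξ(· + s) - ξ(s)` under the
density `e^{ξ(s)}` does not depend on `s`. Passing to these increments lowers `M` by `ξ(s)`, moves
`T` by `-s` and fixes `F`, so `E[e^M; (T, F) ∈ ·]` is invariant under translations of `T`.
Uniqueness of Haar measure, applied for each set of shapes, makes it a product
(`exists_markIntensity_eq_prod`).

Haar uniqueness needs local finiteness. As a coordinatewise infimum, `T` need not be a maximiser, so
`e^M` cannot be bounded by the field near `T`. A mass transport argument
(`markIntensity_cell_ne_top`) replaces `T` by a true maximiser, and Fernique's theorem bounds the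
exponential moment of the field on a cube. -/

namespace BrownResnick

/-! ### The exponential on `[0, ∞]` and the Laplace transform of Poisson laws. -/

/-- The function `a ↦ e^{-a}` on `[0, ∞]`. -/
noncomputable def lap (a : ℝ≥0∞) : ℝ≥0∞ := EReal.exp (-(a : EReal))

theorem continuous_lap : Continuous lap :=
  ENNReal.continuous_exp.comp (continuous_neg.comp continuous_coe_ennreal_ereal)

theorem measurable_lap : Measurable lap := continuous_lap.measurable

theorem measurable_one_sub_lap : Measurable fun a => 1 - lap a := measurable_const.sub measurable_lap

@[simp] theorem lap_zero : lap 0 = 1 := by simp [lap]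

theorem lap_antitone : Antitone lap := fun _ _ h =>
  EReal.exp_monotone (EReal.neg_le_neg_iff.2 (EReal.coe_ennreal_le_coe_ennreal_iff.2 h))

theorem lap_injective : Function.Injective lap := fun a b h => by
  simpa using EReal.exp_strictMono.injective h

theorem lap_le_one (a : ℝ≥0∞) : lap a ≤ 1 := lap_zero ▸ lap_antitone (zero_le)

theorem lap_ne_top (a : ℝ≥0∞) : lap a ≠ ∞ := ((lap_le_one a).trans_lt ENNReal.one_lt_top).ne

theorem lap_add (a b : ℝ≥0∞) : lap (a + b) = lap a * lap b := by
  rw [lap, lap, lap, ← EReal.exp_add, EReal.coe_ennreal_add, EReal.neg_add]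
  · rfl
  all_goals simp

theorem lap_sum {ι : Type*} (s : Finset ι) (f : ι → ℝ≥0∞) :
    lap (∑ i ∈ s, f i) = ∏ i ∈ s, lap (f i) := by
  classical
  induction s using Finset.induction_on with
  | empty => simp
  | insert a s ha ih => rw [Finset.sum_insert ha, Finset.prod_insert ha, lap_add, ih]

theorem lap_mul_natCast (c : ℝ≥0∞) (n : ℕ) : lap (c * n) = lap c ^ n := by
  induction n with
  | zero => simp
  | succ n ih => rw [Nat.cast_succ, mul_add, mul_one, lap_add, ih, pow_succ]

theorem lap_ofReal {x : ℝ} (hx : 0 ≤ x) : lap (ENNReal.ofReal x) = ENNReal.ofReal (Real.exp (-x)) := by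
  rw [lap, EReal.coe_ennreal_ofReal, max_eq_left hx, ← EReal.coe_neg, EReal.exp_coe]

/-- The inverse of `lap` on `[0, 1]`. -/
noncomputable def lapInv (p : ℝ≥0∞) : ℝ≥0∞ := (-ENNReal.log p).toENNReal

theorem measurable_lapInv : Measurable lapInv :=
  measurable_ereal_toENNReal.comp (continuous_neg.measurable.comp ENNReal.measurable_log)

theorem lap_lapInv {p : ℝ≥0∞} (hp : p ≤ 1) : lap (lapInv p) = p := by
  rw [lap, lapInv, EReal.coe_toENNReal, neg_neg, ENNReal.exp_log]
  have h : ENNReal.log p ≤ 0 := by simpa using hp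
  simpa using h

/-- The Poisson generating function at `u = e^{-c}` is `e^{-(1-u)r}`. For `r = ∞` the convention `0
· ∞ = 0` makes the formula hold at `c = 0` too. -/
theorem lintegral_lap_poissonLaw (c r : ℝ≥0∞) :
    ∫⁻ n, lap (c * n) ∂poissonLaw r = lap ((1 - lap c) * r) := by
  have hm : Measurable fun n : ℝ≥0∞ => lap (c * n) := measurable_lap.comp (measurable_const_mul c)
  unfold poissonLaw
  split_ifs with hr
  · rw [lintegral_dirac' _ hm, hr]
    rcases eq_or_ne c 0 with rfl | hc
    · simp
    · have : lap c < 1 := lt_of_le_of_ne (lap_le_one c) fun h => hc (lap_injective (by simpa using h))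
      rw [ENNReal.mul_top hc, ENNReal.mul_top (tsub_pos_of_lt this).ne']
  · lift r to ℝ≥0 using hr
    obtain ⟨u, hu⟩ : ∃ u : ℝ≥0, lap c = u := ⟨(lap c).toNNReal, (ENNReal.coe_toNNReal (lap_ne_top c)).symm⟩
    have hu1 : (u : ℝ) ≤ 1 := by have := lap_le_one c; rw [hu] at this; exact_mod_cast this
    rw [lintegral_map hm (by fun_prop), ENNReal.toNNReal_coe, poissonMeasure, lintegral_sum_measure]
    simp only [lintegral_smul_measure, lintegral_dirac, lap_mul_natCast, hu]
    have h1 : ∀ n : ℕ, ENNReal.ofReal (Real.exp (-r) * r ^ n / n.factorial) • (u : ℝ≥0∞) ^ n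
        = ENNReal.ofReal (Real.exp (-r) * ((r * u) ^ n / n.factorial)) := fun n => by
      rw [smul_eq_mul, ← ENNReal.ofReal_coe_nnreal (p := u), ← ENNReal.ofReal_pow (by positivity),
        ← ENNReal.ofReal_mul (by positivity)]
      congr 1; ring
    simp_rw [h1]
    have h2 := (NormedSpace.expSeries_div_hasSum_exp ((r : ℝ) * u)).mul_left (Real.exp (-r))
    rw [← ENNReal.ofReal_tsum_of_nonneg (fun n => by positivity) h2.summable, h2.tsum_eq,
      ← Real.exp_eq_exp_ℝ, ← Real.exp_add]
    have h3 : (1 - (u : ℝ≥0∞)) * r = ENNReal.ofReal ((1 - u) * r) := by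
      rw [ENNReal.ofReal_mul (by linarith), ENNReal.ofReal_sub _ u.coe_nonneg]
      simp
    rw [h3, lap_ofReal (mul_nonneg (sub_nonneg.2 hu1) r.coe_nonneg)]
    congr 2; ring

theorem lintegral_prod_of_iIndepFun {Ω ι : Type*} [MeasurableSpace Ω] {P : Measure Ω} (s : Finset ι)
    {X : ι → Ω → ℝ≥0∞} (hX : iIndepFun X P) (hm : ∀ i, AEMeasurable (X i) P) :
    ∫⁻ ω, ∏ i ∈ s, X i ω ∂P = ∏ i ∈ s, ∫⁻ ω, X i ω ∂P := by
  have h := lintegral_prod_eq_prod_lintegral_of_indepFun s (fun i => (hm i).mk _)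
    (hX.congr fun i => (hm i).ae_eq_mk) fun i => (hm i).measurable_mk
  rw [Finset.prod_congr rfl fun i _ => lintegral_congr_ae (hm i).ae_eq_mk, ← h]
  refine lintegral_congr_ae ?_
  have : ∀ᵐ ω ∂P, ∀ i ∈ s, X i ω = (hm i).mk _ ω :=
    (Finset.eventually_all s).2 fun i _ => (hm i).ae_eq_mk
  filter_upwards [this] with ω hω
  exact Finset.prod_congr rfl hω

/-! ### The Laplace functional of a Poisson process. -/

section Laplace

variable {Ω S : Type*} [MeasurableSpace Ω] [TopologicalSpace S] [MeasurableSpace S]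
  {N : Ω → Measure S} {μ : Measure S} {P : Measure Ω}

theorem IsPoissonPointProcess.aemeasurable_apply (h : IsPoissonPointProcess N μ P) {A : Set S}
    (hA : MeasurableSet A) : AEMeasurable (fun ω => N ω A) P :=
  (Measure.measurable_coe hA).comp_aemeasurable h.aemeasurable

/-- The level sets of `f` are disjoint, so the exponential of the integral is a product of
independent factors, each a Poisson Laplace transform. -/
theorem IsPoissonPointProcess.lintegral_lap_simpleFunc (h : IsPoissonPointProcess N μ P)
    (f : SimpleFunc S ℝ≥0∞) :
    ∫⁻ ω, lap (∫⁻ x, f x ∂N ω) ∂P = lap (∫⁻ x, (1 - lap (f x)) ∂μ) := by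
  let e := f.range.equivFin.symm
  let A : Fin f.range.card → Set S := fun i => f ⁻¹' {(e i : ℝ≥0∞)}
  have hA : ∀ i, MeasurableSet (A i) := fun i => f.measurableSet_preimage _
  have hd : Pairwise fun i j => Disjoint (A i) (A j) := fun i j hij => by
    refine Disjoint.preimage _ (Set.disjoint_singleton.2 fun he => hij ?_)
    exact e.injective (Subtype.ext he)
  have key : ∀ (g : ℝ≥0∞ → ℝ≥0∞) (ν : Measure S), ∫⁻ x, g (f x) ∂ν = ∑ i, g (e i) * ν (A i) := by
    intro g ν
    have : (fun x => g (f x)) = (f.map g : S → ℝ≥0∞) := rfl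
    rw [this, SimpleFunc.lintegral_eq_lintegral, SimpleFunc.map_lintegral,
      ← Finset.sum_coe_sort, ← e.sum_comp]
  have hi := h.indep _ A hA hd
  have h1 : ∀ ω, lap (∫⁻ x, f x ∂N ω) = ∏ i, lap (e i * N ω (A i)) := fun ω => by
    rw [key (fun x => x), lap_sum]
  simp_rw [h1]
  have hcm : ∀ i, Measurable fun n : ℝ≥0∞ => lap ((e i : ℝ≥0∞) * n) := fun i =>
    measurable_lap.comp (measurable_const_mul _)
  refine (lintegral_prod_of_iIndepFun _ (hi.comp _ hcm) fun i =>
    (hcm i).comp_aemeasurable (h.aemeasurable_apply (hA i))).trans ?_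
  rw [key (fun x => 1 - lap x), lap_sum]
  refine Finset.prod_congr rfl fun i _ => ?_
  rw [← lintegral_lap_poissonLaw, ← h.law _ (hA i), lintegral_map' (hcm i).aemeasurable
    (h.aemeasurable_apply (hA i))]
  rfl

/-- The Laplace functional of a Poisson point process. -/
theorem IsPoissonPointProcess.lintegral_lap [IsProbabilityMeasure P]
    (h : IsPoissonPointProcess N μ P) {f : S → ℝ≥0∞} (hf : Measurable f) :
    ∫⁻ ω, lap (∫⁻ x, f x ∂N ω) ∂P = lap (∫⁻ x, (1 - lap (f x)) ∂μ) := by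
  let F := SimpleFunc.eapprox f
  have hFm : Monotone F := SimpleFunc.monotone_eapprox f
  have hF : ∀ x, Tendsto (fun n => F n x) atTop (𝓝 (f x)) := fun x => by
    rw [← SimpleFunc.iSup_eapprox_apply hf x]
    exact tendsto_atTop_iSup fun i j hij => hFm hij x
  have hl : ∀ ω, Tendsto (fun n => lap (∫⁻ x, F n x ∂N ω)) atTop (𝓝 (lap (∫⁻ x, f x ∂N ω))) :=
    fun ω => (continuous_lap.tendsto _).comp (lintegral_tendsto_of_tendsto_of_monotone
      (fun n => (F n).measurable.aemeasurable) (Eventually.of_forall fun x i j hij => hFm hij x)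
      (Eventually.of_forall hF))
  have hmeas : ∀ n, AEMeasurable (fun ω => lap (∫⁻ x, F n x ∂N ω)) P := fun n =>
    (measurable_lap.comp (Measure.measurable_lintegral (F n).measurable)).comp_aemeasurable
      h.aemeasurable
  have h1 : Tendsto (fun n => ∫⁻ ω, lap (∫⁻ x, F n x ∂N ω) ∂P) atTop
      (𝓝 (∫⁻ ω, lap (∫⁻ x, f x ∂N ω) ∂P)) :=
    tendsto_lintegral_of_dominated_convergence' (fun _ => 1) hmeas
      (fun n => Eventually.of_forall fun ω => lap_le_one _) (by simp) (Eventually.of_forall hl)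
  have hc : Continuous fun a : ℝ≥0∞ => 1 - lap a :=
    ENNReal.continuous_sub_left ENNReal.one_ne_top |>.comp continuous_lap
  have h2 : Tendsto (fun n => ∫⁻ x, (1 - lap (F n x)) ∂μ) atTop (𝓝 (∫⁻ x, (1 - lap (f x)) ∂μ)) :=
    lintegral_tendsto_of_tendsto_of_monotone
      (fun n => (hc.measurable.comp (F n).measurable).aemeasurable)
      (Eventually.of_forall fun x i j hij => tsub_le_tsub_left (lap_antitone (hFm hij x)) _)
      (Eventually.of_forall fun x => (hc.tendsto _).comp (hF x))
  refine tendsto_nhds_unique h1 ?_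
  simp_rw [h.lintegral_lap_simpleFunc]
  exact (continuous_lap.tendsto _).comp h2

end Laplace

/-! ### Laplace transforms determine laws on `[0, ∞]^n`. -/

section Moments

/-- Monomials in the variables `e^{-x_i}` separate finite measures on `[0, ∞]^n`. -/
theorem ext_of_lintegral_lap_sum {n : ℕ} {μ ν : Measure (Fin n → ℝ≥0∞)} [IsFiniteMeasure μ]
    [IsFiniteMeasure ν]
    (h : ∀ m : Fin n → ℕ, ∫⁻ x, lap (∑ i, m i * x i) ∂μ = ∫⁻ x, lap (∑ i, m i * x i) ∂ν) :
    μ = ν := by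
  have hcont : ∀ m : Fin n → ℕ, Continuous fun x : Fin n → ℝ≥0∞ => lap (∑ i, m i * x i) := fun m =>
    continuous_lap.comp <| continuous_finsetSum _ fun i _ =>
      (ENNReal.continuous_const_mul (by simp)).comp (continuous_apply i)
  let mono : (Fin n → ℕ) → BoundedContinuousFunction (Fin n → ℝ≥0∞) ℝ := fun m =>
    BoundedContinuousFunction.mkOfCompact ⟨fun x => (lap (∑ i, m i * x i)).toReal,
      ENNReal.continuousOn_toReal.comp_continuous (hcont m) fun x => lap_ne_top _⟩
  have hmono : ∀ m x, mono m x = (lap (∑ i, m i * x i)).toReal := fun _ _ => rfl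
  have hmul : ∀ m m', mono m * mono m' = mono (m + m') := fun m m' => by
    ext x
    simp only [BoundedContinuousFunction.mul_apply, hmono, ← ENNReal.toReal_mul, ← lap_add,
      ← Finset.sum_add_distrib, Pi.add_apply, Nat.cast_add, add_mul]
  have hone : mono 0 = 1 := by
    ext x; simp [hmono]
  clear_value mono
  -- Monomials are closed under products, so their linear span is already a subalgebra. It separates
  -- points because `lap` is injective up to and including `∞`.
  let M : Submonoid (BoundedContinuousFunction (Fin n → ℝ≥0∞) ℝ) :=
    { carrier := Set.range mono
      mul_mem' := by rintro _ _ ⟨m, rfl⟩ ⟨m', rfl⟩; exact ⟨_, (hmul m m').symm⟩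
      one_mem' := ⟨0, hone⟩ }
  have hstar : ∀ a : BoundedContinuousFunction (Fin n → ℝ≥0∞) ℝ, star a = a := fun a => by
    ext x; simp
  obtain ⟨B, hB⟩ : ∃ B : Subalgebra ℝ (BoundedContinuousFunction (Fin n → ℝ≥0∞) ℝ),
      ∀ g, g ∈ B ↔ g ∈ Submodule.span ℝ (Set.range mono) :=
    ⟨Algebra.adjoin ℝ (M : Set _), fun g => by
      rw [← Subalgebra.mem_toSubmodule, Algebra.adjoin_eq_span, Submonoid.closure_eq]
      rfl⟩
  let A : StarSubalgebra ℝ (BoundedContinuousFunction (Fin n → ℝ≥0∞) ℝ) :=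
    ⟨B, fun {a} ha => by rw [hstar]; exact ha⟩
  have hA : ∀ g, g ∈ A ↔ g ∈ Submodule.span ℝ (Set.range mono) := hB
  clear_value A
  refine ext_of_forall_mem_subalgebra_integral_eq_of_polish (A := A) ?_ ?_
  · intro x y hxy
    obtain ⟨i, hi⟩ := Function.ne_iff.1 hxy
    have hmem : mono (Pi.single i 1) ∈ A := (hA _).2 (Submodule.subset_span ⟨Pi.single i 1, rfl⟩)
    refine ⟨mono (Pi.single i 1), ⟨_, ⟨_, hmem, rfl⟩, rfl⟩, fun he => hi ?_⟩
    have hp : ∀ z : Fin n → ℝ≥0∞, ∑ j, ((Pi.single i 1 : Fin n → ℕ) j : ℝ≥0∞) * z j = z i := by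
      intro z
      rw [Finset.sum_eq_single i]
      · simp
      · intro j _ hj; simp [hj]
      · simp
    rw [hmono, hmono, hp, hp, ENNReal.toReal_eq_toReal_iff' (lap_ne_top _) (lap_ne_top _)] at he
    exact lap_injective he
  · intro g hg
    rw [hA] at hg
    induction hg using Submodule.span_induction with
    | mem g hg =>
      obtain ⟨m, rfl⟩ := hg
      simp only [hmono]
      rw [integral_toReal (hcont m).measurable.aemeasurable
          (Eventually.of_forall fun x => (lap_ne_top _).lt_top),
        integral_toReal (hcont m).measurable.aemeasurable
          (Eventually.of_forall fun x => (lap_ne_top _).lt_top), h]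
    | zero => simp
    | add f g _ _ hf hg =>
      simp only [BoundedContinuousFunction.coe_add, Pi.add_apply]
      rw [integral_add (f.integrable _) (g.integrable _), integral_add (f.integrable _) (g.integrable _),
        hf, hg]
    | smul c f _ hf =>
      simp only [BoundedContinuousFunction.coe_smul, integral_smul, hf]

instance (r : ℝ≥0∞) : IsProbabilityMeasure (poissonLaw r) := by
  unfold poissonLaw
  split_ifs
  · infer_instance
  · exact Measure.isProbabilityMeasure_map (by fun_prop)

end Moments

/-! ### Recognising a Poisson process by its Laplace functional. -/

section PointSum

variable {Ω S : Type*} [MeasurableSpace S]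

theorem lintegral_pointSum (Y : ℕ → Ω → S) (ω : Ω) {f : S → ℝ≥0∞} (hf : Measurable f) :
    ∫⁻ x, f x ∂pointSum Y ω = ∑' i, f (Y i ω) := by
  simp_rw [pointSum, lintegral_sum_measure, lintegral_dirac' _ hf]

theorem pointSum_apply (Y : ℕ → Ω → S) (ω : Ω) {A : Set S} (hA : MeasurableSet A) :
    pointSum Y ω A = ∑' i, A.indicator 1 (Y i ω) := by
  rw [← lintegral_pointSum Y ω (measurable_one.indicator hA), lintegral_indicator_one hA]

theorem exists_pointSum_eq_natCast (Y : ℕ → Ω → S) (ω : Ω) {A : Set S} (hA : MeasurableSet A) :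
    ∃ k : ℕ∞, pointSum Y ω A = (k : ℝ≥0∞) := by
  classical
  refine ⟨{i | Y i ω ∈ A}.encard, ?_⟩
  rw [pointSum_apply Y ω hA, ← ENNReal.tsum_set_one, tsum_subtype _ (fun _ => (1 : ℝ≥0∞))]
  exact tsum_congr fun i => by simp [Set.indicator_apply]

variable [MeasurableSpace Ω] {P : Measure Ω} {Y : ℕ → Ω → S}

theorem aemeasurable_pointSum (hY : ∀ i, AEMeasurable (Y i) P) : AEMeasurable (pointSum Y) P := by
  refine ⟨pointSum fun i => (hY i).mk, ?_, ?_⟩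
  · refine Measure.measurable_of_measurable_coe _ fun A hA => ?_
    simp_rw [pointSum_apply _ _ hA]
    exact Measurable.tsum fun i =>
      (measurable_one.indicator hA).comp (hY i).measurable_mk
  · filter_upwards [ae_all_iff.2 fun i => (hY i).ae_eq_mk] with ω hω
    simp only [pointSum, hω]

/-- Test with `∑ m_i 1_{A_i}`: at most one term is nonzero at each point, so `1 - e^{-·}` passes
through the sum and the Laplace transform factorises. This gives independence and the marginal laws
at once. -/
theorem map_apply_eq_pi_of_lintegral_lap [IsProbabilityMeasure P] {N : Ω → Measure S}
    (hN : AEMeasurable N P) {μ : Measure S}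
    (h : ∀ f : S → ℝ≥0∞, Measurable f →
      ∫⁻ ω, lap (∫⁻ x, f x ∂N ω) ∂P = lap (∫⁻ x, (1 - lap (f x)) ∂μ))
    {n : ℕ} {A : Fin n → Set S} (hA : ∀ i, MeasurableSet (A i))
    (hd : Pairwise fun i j => Disjoint (A i) (A j)) :
    P.map (fun ω i => N ω (A i)) = Measure.pi fun i => poissonLaw (μ (A i)) := by
  have hNA : AEMeasurable (fun ω i => N ω (A i)) P := aemeasurable_pi_lambda _ fun i =>
    (Measure.measurable_coe (hA i)).comp_aemeasurable hN
  have := Measure.isProbabilityMeasure_map (μ := P) hNA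
  refine ext_of_lintegral_lap_sum fun m => ?_
  have hm : Measurable fun x : Fin n → ℝ≥0∞ => lap (∑ i, m i * x i) :=
    measurable_lap.comp (by fun_prop)
  rw [lintegral_map' hm.aemeasurable hNA]
  have hsum : ∀ (c : Fin n → ℝ≥0∞) (ν : Measure S),
      ∫⁻ x, ∑ i, (A i).indicator (fun _ => c i) x ∂ν = ∑ i, c i * ν (A i) := fun c ν => by
    rw [lintegral_finsetSum _ fun i _ => measurable_const.indicator (hA i)]
    exact Finset.sum_congr rfl fun i _ => lintegral_indicator_const (hA i) _
  simp_rw [← hsum (fun i => (m i : ℝ≥0∞))]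
  rw [h _ (Finset.measurable_sum _ fun i _ => measurable_const.indicator (hA i))]
  have hpt : ∀ x, 1 - lap (∑ i, (A i).indicator (fun _ => (m i : ℝ≥0∞)) x)
      = ∑ i, (A i).indicator (fun _ => 1 - lap (m i)) x := fun x => by
    by_cases hx : ∃ i, x ∈ A i
    · obtain ⟨i, hi⟩ := hx
      have hj : ∀ j, j ≠ i → x ∉ A j := fun j hj hxj => Set.disjoint_left.1 (hd hj) hxj hi
      rw [Finset.sum_eq_single i (fun j _ h => Set.indicator_of_notMem (hj j h) _) (by simp),
        Finset.sum_eq_single i (fun j _ h => Set.indicator_of_notMem (hj j h) _) (by simp),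
        Set.indicator_of_mem hi, Set.indicator_of_mem hi]
    · push Not at hx
      simp [Set.indicator_of_notMem (hx _)]
  simp_rw [hpt]
  rw [hsum, lap_sum]
  simp_rw [lap_sum, ← lintegral_lap_poissonLaw]
  have hcm : ∀ i, Measurable fun x : ℝ≥0∞ => lap (m i * x) := fun i =>
    measurable_lap.comp (measurable_const_mul _)
  have hi := iIndepFun_pi (μ := fun i => poissonLaw (μ (A i)))
    (X := fun i x => lap (m i * x)) fun i => (hcm i).aemeasurable
  rw [lintegral_prod_of_iIndepFun _ hi fun i => ((hcm i).comp (measurable_pi_apply i)).aemeasurable]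
  refine Finset.prod_congr rfl fun i _ => ?_
  rw [← (measurePreserving_eval (fun i => poissonLaw (μ (A i))) i).lintegral_comp (hcm i)]

/-- A point process with the Laplace functional of a Poisson point process is one. -/
theorem isPoissonPointProcess_of_lintegral_lap [TopologicalSpace S] [IsProbabilityMeasure P]
    (hY : ∀ i, AEMeasurable (Y i) P) {μ : Measure S} [IsLocallyFiniteMeasure μ]
    (h : ∀ f : S → ℝ≥0∞, Measurable f →
      ∫⁻ ω, lap (∑' i, f (Y i ω)) ∂P = lap (∫⁻ x, (1 - lap (f x)) ∂μ)) :
    IsPoissonPointProcess (pointSum Y) μ P := by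
  have hN := aemeasurable_pointSum hY
  have h' : ∀ f : S → ℝ≥0∞, Measurable f →
      ∫⁻ ω, lap (∫⁻ x, f x ∂pointSum Y ω) ∂P = lap (∫⁻ x, (1 - lap (f x)) ∂μ) := fun f hf => by
    simp_rw [lintegral_pointSum Y _ hf]; exact h f hf
  have hNA : ∀ {A : Set S}, MeasurableSet A → AEMeasurable (fun ω => pointSum Y ω A) P :=
    fun hA => (Measure.measurable_coe hA).comp_aemeasurable hN
  have hlaw : ∀ A, MeasurableSet A → P.map (fun ω => pointSum Y ω A) = poissonLaw (μ A) := by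
    intro A hA
    have h1 := map_apply_eq_pi_of_lintegral_lap hN h' (n := 1) (A := fun _ => A) (fun _ => hA)
      (fun i j hij => absurd (Subsingleton.elim i j) hij)
    have h2 := congrArg (Measure.map (fun x : Fin 1 → ℝ≥0∞ => x 0)) h1
    rw [AEMeasurable.map_map_of_aemeasurable (measurable_pi_apply 0).aemeasurable
      (aemeasurable_pi_lambda _ fun _ => hNA hA),
      (measurePreserving_eval (fun _ : Fin 1 => poissonLaw (μ A)) 0).map_eq] at h2
    exact h2
  refine ⟨inferInstance, hN, fun ω A hA => exists_pointSum_eq_natCast Y ω hA, ?_, hlaw⟩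
  intro n A hA hd
  rw [iIndepFun_iff_map_fun_eq_pi_map fun i => hNA (hA i), map_apply_eq_pi_of_lintegral_lap hN h' hA hd]
  simp_rw [fun i => hlaw (A i) (hA i)]

end PointSum

/-! ### Independent marking. -/

section Marking

variable {Ω E D : Type*} [MeasurableSpace Ω] [MeasurableSpace E] [MeasurableSpace D]
  {P : Measure Ω} [IsProbabilityMeasure P] {X : ℕ → Ω → E} {V : ℕ → Ω → D} {ν : Measure D}

/-- Fubini: with the points frozen, the marks are still i.i.d. and can be integrated out one by one.
-/
theorem lintegral_prod_comp_indep (hX : ∀ i, AEMeasurable (X i) P) (hV : ∀ i, AEMeasurable (V i) P)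
    (hVi : iIndepFun V P) (hν : ∀ i, P.map (V i) = ν)
    (hXV : IndepFun (fun ω i => X i ω) (fun ω i => V i ω) P) {g : E × D → ℝ≥0∞} (hg : Measurable g)
    (n : ℕ) :
    ∫⁻ ω, ∏ i ∈ Finset.range n, g (X i ω, V i ω) ∂P
      = ∫⁻ ω, ∏ i ∈ Finset.range n, (∫⁻ w, g (X i ω, w) ∂ν) ∂P := by
  have hX' : AEMeasurable (fun ω i => X i ω) P := aemeasurable_pi_lambda _ hX
  have hV' : AEMeasurable (fun ω i => V i ω) P := aemeasurable_pi_lambda _ hV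
  have := Measure.isProbabilityMeasure_map (μ := P) hV'
  have : IsProbabilityMeasure ν := hν 0 ▸ Measure.isProbabilityMeasure_map (hV 0)
  have hlaw := (indepFun_iff_map_prod_eq_prod_map_map hX' hV').1 hXV
  have hG : Measurable fun z : (ℕ → E) × (ℕ → D) => ∏ i ∈ Finset.range n, g (z.1 i, z.2 i) :=
    Finset.measurable_fun_prod _ fun i _ => hg.comp (by fun_prop)
  have hp : Measurable fun x : E => ∫⁻ w, g (x, w) ∂ν := hg.lintegral_prod_right'
  have hp' : Measurable fun x : ℕ → E => ∏ i ∈ Finset.range n, ∫⁻ w, g (x i, w) ∂ν :=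
    Finset.measurable_fun_prod _ fun i _ => hp.comp (measurable_pi_apply i)
  have h1 : ∫⁻ ω, ∏ i ∈ Finset.range n, g (X i ω, V i ω) ∂P
      = ∫⁻ z, ∏ i ∈ Finset.range n, g (z.1 i, z.2 i) ∂(P.map fun ω => (fun i => X i ω, fun i => V i ω)) :=
    (lintegral_map' hG.aemeasurable (hX'.prodMk hV')).symm
  have h2 : ∫⁻ ω, ∏ i ∈ Finset.range n, (∫⁻ w, g (X i ω, w) ∂ν) ∂P
      = ∫⁻ x, ∏ i ∈ Finset.range n, (∫⁻ w, g (x i, w) ∂ν) ∂(P.map fun ω i => X i ω) :=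
    (lintegral_map' hp'.aemeasurable hX').symm
  rw [h1, h2, hlaw, lintegral_prod _ hG.aemeasurable]
  refine lintegral_congr fun x => ?_
  have hgx : ∀ i, Measurable fun w => g (x i, w) := fun i => hg.comp measurable_prodMk_left
  refine (lintegral_map' (hG.comp measurable_prodMk_left).aemeasurable hV').trans ?_
  refine (lintegral_prod_of_iIndepFun _ (hVi.comp _ hgx) fun i =>
    (hgx i).comp_aemeasurable (hV i)).trans ?_
  refine Finset.prod_congr rfl fun i _ => ?_
  rw [← hν i, lintegral_map' (hgx i).aemeasurable (hV i)]
  rfl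

/-- The Laplace functional of an independently marked Poisson point process. -/
theorem lintegral_lap_tsum_marked [TopologicalSpace E] {μ : Measure E}
    (hX : ∀ i, AEMeasurable (X i) P) (hP : IsPoissonPointProcess (pointSum X) μ P)
    (hV : ∀ i, AEMeasurable (V i) P) (hVi : iIndepFun V P) (hν : ∀ i, P.map (V i) = ν)
    (hXV : IndepFun (fun ω i => X i ω) (fun ω i => V i ω) P) {g : E × D → ℝ≥0∞} (hg : Measurable g) :
    ∫⁻ ω, lap (∑' i, g (X i ω, V i ω)) ∂P = lap (∫⁻ z, (1 - lap (g z)) ∂μ.prod ν) := by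
  have : IsProbabilityMeasure ν := hν 0 ▸ Measure.isProbabilityMeasure_map (hV 0)
  let p : E → ℝ≥0∞ := fun x => ∫⁻ w, lap (g (x, w)) ∂ν
  have hlg : Measurable fun z => lap (g z) := measurable_lap.comp hg
  have hpm : Measurable p := hlg.lintegral_prod_right'
  have hp1 : ∀ x, p x ≤ 1 := fun x => by
    calc p x ≤ ∫⁻ _, 1 ∂ν := lintegral_mono fun w => lap_le_one _
      _ = 1 := by simp
  -- `f` is chosen so that `e^{-f(x)}` is the mark average of `e^{-g(x, ·)}`; it may be `∞`. The
  -- marked functional thus becomes the unmarked one at `f`.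
  let f : E → ℝ≥0∞ := fun x => lapInv (p x)
  have hf : Measurable f := measurable_lapInv.comp hpm
  have hfp : ∀ x, lap (f x) = p x := fun x => lap_lapInv (hp1 x)
  have hlim : ∀ u : ℕ → Ω → ℝ≥0∞, (∀ i, AEMeasurable (u i) P) →
      Tendsto (fun n => ∫⁻ ω, ∏ i ∈ Finset.range n, lap (u i ω) ∂P) atTop
        (𝓝 (∫⁻ ω, lap (∑' i, u i ω) ∂P)) := fun u hu => by
    refine tendsto_lintegral_of_dominated_convergence' (fun _ => 1) (fun n => ?_)
      (fun n => Eventually.of_forall fun ω => ?_) (by simp) (Eventually.of_forall fun ω => ?_)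
    · exact Finset.aemeasurable_fun_prod _ fun i _ => measurable_lap.comp_aemeasurable (hu i)
    · simpa [← lap_sum] using lap_le_one _
    · simp_rw [← lap_sum]
      exact (continuous_lap.tendsto _).comp ENNReal.summable.hasSum.tendsto_sum_nat
  have h1 := hlim (fun i ω => g (X i ω, V i ω)) fun i => hg.comp_aemeasurable ((hX i).prodMk (hV i))
  have h2 := hlim (fun i ω => f (X i ω)) fun i => hf.comp_aemeasurable (hX i)
  simp_rw [lintegral_prod_comp_indep hX hV hVi hν hXV hlg] at h1
  simp_rw [hfp] at h2
  rw [tendsto_nhds_unique h1 h2]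
  simp_rw [← lintegral_pointSum X _ hf]
  rw [hP.lintegral_lap hf, lintegral_prod (fun z => 1 - lap (g z)) (measurable_one_sub_lap.comp hg).aemeasurable]
  congr 1
  refine lintegral_congr fun x => ?_
  have hlgx : Measurable fun w => lap (g (x, w)) := hlg.comp measurable_prodMk_left
  rw [lintegral_sub hlgx ((hp1 x).trans_lt ENNReal.one_lt_top).ne (Eventually.of_forall fun w => lap_le_one _), hfp]
  simp [p]

/-- Marking and mapping of a Poisson point process. -/
theorem IsPoissonPointProcess.pointSum_marked [TopologicalSpace E] {S : Type*} [TopologicalSpace S]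
    [MeasurableSpace S] {μ : Measure E} (hP : IsPoissonPointProcess (pointSum X) μ P)
    (hX : ∀ i, AEMeasurable (X i) P) (hV : ∀ i, AEMeasurable (V i) P) (hVi : iIndepFun V P)
    (hν : ∀ i, P.map (V i) = ν) (hXV : IndepFun (fun ω i => X i ω) (fun ω i => V i ω) P)
    {Φ : E × D → S} (hΦ : Measurable Φ) {Y : ℕ → Ω → S}
    (hY : ∀ i, Y i =ᵐ[P] fun ω => Φ (X i ω, V i ω)) {ρ : Measure S} [IsLocallyFiniteMeasure ρ]
    (hρ : (μ.prod ν).map Φ = ρ) :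
    IsPoissonPointProcess (pointSum Y) ρ P := by
  refine isPoissonPointProcess_of_lintegral_lap (fun i =>
    (hΦ.comp_aemeasurable ((hX i).prodMk (hV i))).congr (hY i).symm) fun f hf => ?_
  have h1 : ∫⁻ ω, lap (∑' i, f (Y i ω)) ∂P = ∫⁻ ω, lap (∑' i, f (Φ (X i ω, V i ω))) ∂P := by
    refine lintegral_congr_ae ?_
    filter_upwards [ae_all_iff.2 hY] with ω hω
    simp only [hω]
  refine (h1.trans (lintegral_lap_tsum_marked hX hP hV hVi hν hXV (hf.comp hΦ))).trans ?_
  rw [← hρ, lintegral_map (f := fun x => 1 - lap (f x)) (measurable_one_sub_lap.comp hf) hΦ]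
  rfl

end Marking

/-! ### Measurability for the evaluation `σ`-algebra. -/

section PathMeasurability

variable {d : ℕ} {α : Type*} [MeasurableSpace α]

theorem measurable_path {f : α → C(Rd d, ℝ)} (h : ∀ t, Measurable fun a => f a t) : Measurable f := by
  refine Measurable.of_le_map (iSup_le fun t => ?_)
  rintro _ ⟨B, hB, rfl⟩
  exact h t hB

theorem measurable_eval_prod : Measurable fun p : C(Rd d, ℝ) × Rd d => p.1 p.2 := by
  have h := measurable_uncurry_of_continuous_of_measurable (u := fun (t : Rd d) (f : C(Rd d, ℝ)) => f t)
    (fun f => f.continuous) measurable_eval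
  exact h.comp measurable_swap

/-- The two ranges have the same closure, hence the same upper bounds. If there are none, both real
suprema take the default value `0`. -/
theorem ciSup_comp_denseSeq {Z : Type*} [TopologicalSpace Z] [TopologicalSpace.SeparableSpace Z]
    [Nonempty Z] {f : Z → ℝ} (hf : Continuous f) :
    ⨆ z, f z = ⨆ n, f (TopologicalSpace.denseSeq Z n) := by
  have hcl : closure (Set.range fun n => f (TopologicalSpace.denseSeq Z n)) = closure (Set.range f) := by
    refine subset_antisymm (closure_mono ?_) (closure_minimal ?_ isClosed_closure)
    · rintro _ ⟨n, rfl⟩; exact ⟨_, rfl⟩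
    · have := hf.range_subset_closure_image_dense (TopologicalSpace.denseRange_denseSeq Z)
      rwa [← Set.range_comp] at this
  by_cases hb : BddAbove (Set.range f)
  · have hb' : BddAbove (Set.range fun n => f (TopologicalSpace.denseSeq Z n)) := by
      rw [← bddAbove_closure, hcl, bddAbove_closure]; exact hb
    have h1 : IsLUB (Set.range f) (⨆ n, f (TopologicalSpace.denseSeq Z n)) := by
      rw [IsLUB, ← upperBounds_closure, ← hcl, upperBounds_closure]
      exact isLUB_ciSup hb'
    exact (isLUB_ciSup hb).unique h1
  · have hb' : ¬ BddAbove (Set.range fun n => f (TopologicalSpace.denseSeq Z n)) := by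
      rw [← bddAbove_closure, hcl, bddAbove_closure]; exact hb
    rw [iSup, iSup, Real.sSup_of_not_bddAbove hb, Real.sSup_of_not_bddAbove hb']

theorem measurable_ciSup_comp {Z : Type*} [TopologicalSpace Z] [TopologicalSpace.SeparableSpace Z]
    [Nonempty Z] {φ : Z → Rd d} (hφ : Continuous φ) :
    Measurable fun ξ : C(Rd d, ℝ) => ⨆ z, ξ (φ z) := by
  have h : (fun ξ : C(Rd d, ℝ) => ⨆ z, ξ (φ z))
      = fun ξ => ⨆ n, ξ (φ (TopologicalSpace.denseSeq Z n)) :=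
    funext fun ξ => ciSup_comp_denseSeq (ξ.continuous.comp hφ)
  rw [h]
  exact Measurable.iSup fun n => measurable_eval _

theorem measurable_pathSup : Measurable (pathSup : C(Rd d, ℝ) → ℝ) :=
  measurable_ciSup_comp continuous_id

theorem measurableSet_forall_mem_le (K : Set (Rd d)) (c : ℝ) :
    MeasurableSet {ξ : C(Rd d, ℝ) | ∀ t ∈ K, ξ t ≤ c} := by
  obtain ⟨u, huK, hu, hKu⟩ := (TopologicalSpace.IsSeparable.of_separableSpace K).exists_countable_dense_subset
  have : {ξ : C(Rd d, ℝ) | ∀ t ∈ K, ξ t ≤ c} = ⋂ t ∈ u, {ξ | ξ t ≤ c} := by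
    ext ξ
    simp only [Set.mem_ofPred_eq, Set.mem_iInter]
    refine ⟨fun h t ht => h t (huK ht), fun h t ht => ?_⟩
    exact closure_minimal (fun t ht => h t ht) (isClosed_le ξ.continuous continuous_const) (hKu ht)
  rw [this]
  exact MeasurableSet.biInter hu fun t _ => measurable_eval t measurableSet_Iic

end PathMeasurability

/-! ### Maximisers of paths tending to `-∞`, and their behaviour under shifts. -/

section Coercive

variable {d : ℕ}

/-- The paths that tend to `-∞` at infinity. -/
def coercivePaths (d : ℕ) : Set C(Rd d, ℝ) := {ξ | Tendsto ξ (cocompact (Rd d)) atBot}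

theorem measurableSet_coercivePaths : MeasurableSet (coercivePaths d) := by
  have : coercivePaths d
      = ⋂ n : ℕ, ⋃ m : ℕ, {ξ : C(Rd d, ℝ) | ∀ t ∈ (Metric.closedBall (0 : Rd d) m)ᶜ, ξ t ≤ -(n : ℝ)} := by
    ext ξ
    simp only [coercivePaths, Set.mem_ofPred_eq, Set.mem_iInter, Set.mem_iUnion, tendsto_atBot]
    have hb := Metric.hasBasis_cobounded_compl_closedBall (0 : Rd d)
    rw [Metric.cobounded_eq_cocompact] at hb
    simp only [hb.eventually_iff, true_and]
    constructor
    · intro h n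
      obtain ⟨r, hr⟩ := h (-n)
      obtain ⟨m, hm⟩ := exists_nat_ge r
      exact ⟨m, fun t ht => hr fun h => ht (Metric.closedBall_subset_closedBall hm h)⟩
    · intro h b
      obtain ⟨n, hn⟩ := exists_nat_ge (-b)
      obtain ⟨m, hm⟩ := h n
      exact ⟨m, fun t ht => (hm t ht).trans (by linarith)⟩
  rw [this]
  exact MeasurableSet.iInter fun n => MeasurableSet.iUnion fun m => measurableSet_forall_mem_le _ _

variable {ξ : C(Rd d, ℝ)}

theorem exists_forall_mem_le_of_mem_coercivePaths (hξ : ξ ∈ coercivePaths d) {K : Set (Rd d)}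
    (hK : IsClosed K) (hne : K.Nonempty) : ∃ t ∈ K, ∀ s ∈ K, ξ s ≤ ξ t := by
  obtain ⟨x, hx⟩ := hne
  obtain ⟨t, ht, h⟩ := ContinuousOn.exists_isMaxOn' ξ.continuous.continuousOn hK hx
    (Filter.Eventually.filter_mono inf_le_left ((tendsto_atBot.1 hξ) (ξ x)))
  exact ⟨t, ht, fun s hs => h hs⟩

theorem argsup_nonempty (hξ : ξ ∈ coercivePaths d) : (argsup ξ).Nonempty := by
  obtain ⟨t, -, h⟩ := exists_forall_mem_le_of_mem_coercivePaths hξ isClosed_univ Set.univ_nonempty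
  exact ⟨t, fun s => h s trivial⟩

theorem pathSup_eq_of_mem_argsup {t : Rd d} (ht : t ∈ argsup ξ) : pathSup ξ = ξ t :=
  le_antisymm (ciSup_le ht) (le_ciSup (f := ξ) ⟨ξ t, by rintro _ ⟨s, rfl⟩; exact ht s⟩ t)

theorem mem_argsup_iff (hξ : ξ ∈ coercivePaths d) {t : Rd d} : t ∈ argsup ξ ↔ ξ t = pathSup ξ := by
  refine ⟨fun h => (pathSup_eq_of_mem_argsup h).symm, fun h s => ?_⟩
  obtain ⟨r, hr⟩ := argsup_nonempty hξ
  rw [h, pathSup_eq_of_mem_argsup hr]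
  exact hr s

theorem isCompact_argsup (hξ : ξ ∈ coercivePaths d) : IsCompact (argsup ξ) := by
  have hc : IsClosed (argsup ξ) := by
    have : argsup ξ = ⋂ s, {t | ξ s ≤ ξ t} := by ext; simp [argsup]
    rw [this]
    exact isClosed_iInter fun s => isClosed_le continuous_const ξ.continuous
  obtain ⟨r, hr⟩ := argsup_nonempty hξ
  obtain ⟨K, hK, h⟩ := mem_cocompact.1 ((tendsto_atBot.1 hξ) (ξ r - 1))
  refine hK.of_isClosed_subset hc fun t ht => by_contra fun hn => ?_
  have h1 : ξ t ≤ ξ r - 1 := h hn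
  have h2 := ht r
  linarith

theorem isCompact_image_argsup (hξ : ξ ∈ coercivePaths d) (j : Fin d) :
    IsCompact ((fun t : Rd d => t j) '' argsup ξ) :=
  (isCompact_argsup hξ).image (by fun_prop)

/-- Coercivity makes both suprema attained. Comparing two measurable suprema then shows that hitting
`K` is a measurable event. -/
theorem inter_argsup_nonempty_iff (hξ : ξ ∈ coercivePaths d) {K : Set (Rd d)} (hK : IsClosed K)
    (hne : K.Nonempty) : (argsup ξ ∩ K).Nonempty ↔ ⨆ t : K, ξ t = pathSup ξ := by
  have := hne.to_subtype
  obtain ⟨r, hr⟩ := argsup_nonempty hξ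
  have hb : BddAbove (Set.range fun t : K => ξ t) := ⟨ξ r, by rintro _ ⟨s, rfl⟩; exact hr s⟩
  constructor
  · rintro ⟨t, ht, htK⟩
    rw [pathSup_eq_of_mem_argsup ht]
    exact le_antisymm (ciSup_le fun s => ht s) (le_ciSup hb ⟨t, htK⟩)
  · intro h
    obtain ⟨t, ht, hm⟩ := exists_forall_mem_le_of_mem_coercivePaths hξ hK hne
    refine ⟨t, (mem_argsup_iff hξ).2 (h ▸ ?_), ht⟩
    exact le_antisymm (le_ciSup hb ⟨t, ht⟩) (ciSup_le fun s => hm s s.2)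

theorem measurableSet_inter_argsup_nonempty {K : Set (Rd d)} (hK : IsClosed K) (hne : K.Nonempty) :
    MeasurableSet {ξ ∈ coercivePaths d | (argsup ξ ∩ K).Nonempty} := by
  have := hne.to_subtype
  have h : {ξ ∈ coercivePaths d | (argsup ξ ∩ K).Nonempty}
      = coercivePaths d ∩ {ξ | ⨆ t : K, ξ t = pathSup ξ} := by
    ext ξ
    exact and_congr_right fun hξ => inter_argsup_nonempty_iff hξ hK hne
  rw [h]
  exact measurableSet_coercivePaths.inter
    (measurableSet_eq_fun (measurable_ciSup_comp continuous_subtype_val) measurable_pathSup)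

/-- The maximisers form a compact set, so each coordinate infimum is attained, though possibly at
different maximisers. Measurability of `T` reduces to hitting half-spaces. -/
theorem argsupInf_apply_le_iff (hξ : ξ ∈ coercivePaths d) (j : Fin d) (a : ℝ) :
    argsupInf ξ j ≤ a ↔ (argsup ξ ∩ {t | t j ≤ a}).Nonempty := by
  have hc := isCompact_image_argsup hξ j
  change sInf _ ≤ a ↔ _
  constructor
  · intro h
    obtain ⟨t, ht, he⟩ := hc.sInf_mem ((argsup_nonempty hξ).image _)
    exact ⟨t, ht, le_trans (le_of_eq he) h⟩
  · rintro ⟨t, ht, hta⟩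
    exact (csInf_le hc.bddBelow ⟨t, ht, rfl⟩).trans hta

open Classical in
/-- A measurable version of `argsupInf`. -/
noncomputable def argsupInf' (ξ : C(Rd d, ℝ)) : Rd d := if ξ ∈ coercivePaths d then argsupInf ξ else 0

theorem argsupInf'_eq (hξ : ξ ∈ coercivePaths d) : argsupInf' ξ = argsupInf ξ := if_pos hξ

theorem measurable_argsupInf' : Measurable (argsupInf' : C(Rd d, ℝ) → Rd d) := by
  have h : Measurable fun (ξ : C(Rd d, ℝ)) (j : Fin d) => argsupInf' ξ j := by
    refine measurable_pi_lambda _ fun j => measurable_of_Iic fun a => ?_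
    -- The second piece comes from the default value `0` off the coercive paths.
    have hs : (fun ξ : C(Rd d, ℝ) => argsupInf' ξ j) ⁻¹' Set.Iic a
        = {ξ ∈ coercivePaths d | (argsup ξ ∩ {t | t j ≤ a}).Nonempty}
          ∪ ((coercivePaths d)ᶜ ∩ {_ξ | 0 ≤ a}) := by
      ext ξ
      by_cases hξ : ξ ∈ coercivePaths d
      · simp [argsupInf'_eq hξ, hξ, argsupInf_apply_le_iff hξ j a]
      · simp [argsupInf', hξ]
    rw [hs]
    refine (measurableSet_inter_argsup_nonempty (isClosed_le (by fun_prop) continuous_const)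
      ⟨EuclideanSpace.single j a, by simp⟩).union (measurableSet_coercivePaths.compl.inter ?_)
    exact MeasurableSet.const _
  exact (WithLp.measurable_toLp 2 (Fin d → ℝ)).comp h

/-- A measurable version of `recentred`. -/
noncomputable def recentred' (ξ : C(Rd d, ℝ)) : C(Rd d, ℝ) :=
  ⟨fun t => ξ (t + argsupInf' ξ) - pathSup ξ, by fun_prop⟩

theorem recentred'_eq (hξ : ξ ∈ coercivePaths d) : recentred' ξ = recentred ξ := by
  ext t; simp [recentred, recentred', argsupInf'_eq hξ]

theorem measurable_recentred' : Measurable (recentred' : C(Rd d, ℝ) → C(Rd d, ℝ)) :=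
  measurable_path fun _ => (measurable_eval_prod.comp
    (measurable_id.prodMk (measurable_const.add measurable_argsupInf'))).sub measurable_pathSup

/-- The increments of the path `ξ` from `s` on. -/
def increments (s : Rd d) (ξ : C(Rd d, ℝ)) : C(Rd d, ℝ) := ⟨fun t => ξ (t + s) - ξ s, by fun_prop⟩

@[simp] theorem increments_apply (s t : Rd d) (ξ : C(Rd d, ℝ)) : increments s ξ t = ξ (t + s) - ξ s := rfl

theorem measurable_increments (s : Rd d) : Measurable (increments s) :=
  measurable_path fun t => (measurable_eval (t + s)).sub (measurable_eval s)

theorem increments_mem_coercivePaths (hξ : ξ ∈ coercivePaths d) (s : Rd d) :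
    increments s ξ ∈ coercivePaths d := by
  have h1 : Tendsto (fun t : Rd d => t + s) (cocompact _) (cocompact _) :=
    (Homeomorph.addRight s).isClosedEmbedding.tendsto_cocompact
  exact tendsto_atBot_add_const_right _ (-ξ s) (Tendsto.comp hξ h1)

theorem mem_argsup_increments {s t : Rd d} : t ∈ argsup (increments s ξ) ↔ t + s ∈ argsup ξ := by
  simp only [argsup, Set.mem_ofPred_eq, increments_apply, sub_le_sub_iff_right]
  exact ⟨fun h r => by simpa using h (r - s), fun h r => h _⟩

/-- This yields `e^{ξ(s)} e^{M(increments s ξ)} = e^{M(ξ)}`, which turns the tilt by `e^{ξ(s)}` into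
the weight `e^M`. -/
theorem pathSup_increments (hξ : ξ ∈ coercivePaths d) (s : Rd d) :
    pathSup (increments s ξ) = pathSup ξ - ξ s := by
  obtain ⟨t, ht⟩ := argsup_nonempty hξ
  rw [pathSup_eq_of_mem_argsup ht, pathSup_eq_of_mem_argsup (t := t - s)
    (mem_argsup_increments.2 (by simpa using ht))]
  simp

theorem argsupInf'_increments (hξ : ξ ∈ coercivePaths d) (s : Rd d) :
    argsupInf' (increments s ξ) = argsupInf' ξ - s := by
  have hs := increments_mem_coercivePaths hξ s
  rw [argsupInf'_eq hξ, argsupInf'_eq hs]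
  ext j
  refine eq_of_forall_ge_iff fun a => ?_
  rw [argsupInf_apply_le_iff hs, PiLp.sub_apply, sub_le_iff_le_add, argsupInf_apply_le_iff hξ]
  constructor
  · rintro ⟨t, ht, hta⟩
    exact ⟨t + s, mem_argsup_increments.1 ht, by simpa using hta⟩
  · rintro ⟨t, ht, hta⟩
    exact ⟨t - s, mem_argsup_increments.2 (by simpa using ht), by simpa using hta⟩

theorem recentred'_increments (hξ : ξ ∈ coercivePaths d) (s : Rd d) :
    recentred' (increments s ξ) = recentred' ξ := by
  ext t
  simp [recentred', argsupInf'_increments hξ, pathSup_increments hξ]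
  congr 1
  abel

end Coercive

/-! ### Measures determined by real exponential moments. -/

section Exponential

/-- Finite moments for all real `z` make the complex moment generating function entire, so its real
values determine it and with it the measure. -/
theorem ext_of_lintegral_exp {μ ν : Measure ℝ} [IsFiniteMeasure μ] [IsFiniteMeasure ν]
    (h : ∀ z : ℝ, ∫⁻ x, ENNReal.ofReal (Real.exp (z * x)) ∂μ
      = ∫⁻ x, ENNReal.ofReal (Real.exp (z * x)) ∂ν)
    (hfin : ∀ z : ℝ, ∫⁻ x, ENNReal.ofReal (Real.exp (z * x)) ∂μ ≠ ∞) : μ = ν := by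
  have hmgf : mgf id μ = mgf id ν := by
    ext z
    simp only [mgf, id]
    rw [integral_eq_lintegral_of_nonneg_ae (Eventually.of_forall fun x => (Real.exp_pos _).le)
        (by fun_prop),
      integral_eq_lintegral_of_nonneg_ae (Eventually.of_forall fun x => (Real.exp_pos _).le)
        (by fun_prop), h]
  have hset : integrableExpSet id μ = Set.univ := by
    ext z
    simp only [integrableExpSet, id, Set.mem_univ, iff_true]
    refine ⟨by fun_prop, ?_⟩
    rw [hasFiniteIntegral_iff_ofReal (Eventually.of_forall fun x => (Real.exp_pos _).le)]
    exact (hfin z).lt_top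
  have h0 : μ = 0 ↔ ν = 0 := by
    have := h 0
    simp only [zero_mul, Real.exp_zero, ENNReal.ofReal_one, lintegral_const, one_mul] at this
    rw [← Measure.measure_univ_eq_zero, this, Measure.measure_univ_eq_zero]
  refine Measure.ext_of_complexMGF_id_eq (funext fun z => ?_)
  exact eqOn_complexMGF_of_mgf' hmgf h0 (by simp [hset])

end Exponential

/-! ### Shift invariance of the tilted increments. -/

section Tilt

variable {d : ℕ}

/-- The law of the increments from `s` on under the measure with density `e^{f(s)}`. -/
noncomputable def tiltedIncrements (μ : Measure C(Rd d, ℝ)) (s : Rd d) : Measure C(Rd d, ℝ) :=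
  (μ.withDensity fun f => ENNReal.ofReal (Real.exp (f s))).map (increments s)

theorem measurable_ofReal_exp_eval (s : Rd d) :
    Measurable fun f : C(Rd d, ℝ) => ENNReal.ofReal (Real.exp (f s)) :=
  (Real.measurable_exp.comp (measurable_eval s)).ennreal_ofReal

theorem lintegral_tiltedIncrements (μ : Measure C(Rd d, ℝ)) (s : Rd d) {g : C(Rd d, ℝ) → ℝ≥0∞}
    (hg : Measurable g) :
    ∫⁻ f, g f ∂tiltedIncrements μ s = ∫⁻ f, ENNReal.ofReal (Real.exp (f s)) * g (increments s f) ∂μ := by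
  rw [tiltedIncrements, lintegral_map hg (measurable_increments s)]
  exact lintegral_withDensity_eq_lintegral_mul _ (measurable_ofReal_exp_eval s)
    (hg.comp (measurable_increments s))

theorem measurable_coeFun_path : Measurable fun (f : C(Rd d, ℝ)) (t : Rd d) => f t :=
  measurable_pi_lambda _ measurable_eval

theorem ext_of_map_coeFun {μ ν : Measure C(Rd d, ℝ)}
    (h : μ.map (fun f t => f t) = ν.map (fun f t => f t)) : μ = ν := by
  have hle : instMeasurableSpacePath d
      ≤ MeasurableSpace.comap (fun (f : C(Rd d, ℝ)) (t : Rd d) => f t) MeasurableSpace.pi := by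
    refine iSup_le fun t => ?_
    rintro _ ⟨B, hB, rfl⟩
    exact ⟨_, measurable_pi_apply t hB, rfl⟩
  ext A hA
  obtain ⟨B, hB, rfl⟩ := hle A hA
  rw [← Measure.map_apply measurable_coeFun_path hB, h, Measure.map_apply measurable_coeFun_path hB]

theorem ext_of_map_restrict {μ ν : Measure C(Rd d, ℝ)} [IsFiniteMeasure μ] [IsFiniteMeasure ν]
    (h : ∀ I : Finset (Rd d), μ.map (fun f (i : I) => f i) = ν.map (fun f (i : I) => f i)) :
    μ = ν := by
  refine ext_of_map_coeFun (IsProjectiveLimit.unique (P := fun I => ν.map (fun f (i : I) => f i)) ?_ ?_)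
  · intro I
    rw [Measure.map_map (Finset.measurable_restrict I) measurable_coeFun_path]
    exact h I
  · intro I
    rw [Measure.map_map (Finset.measurable_restrict I) measurable_coeFun_path]
    rfl

/-- If the exponential moments with total weight one are shift invariant, so is the law of the
tilted increments. -/
theorem tiltedIncrements_eq {μ : Measure C(Rd d, ℝ)} (s : Rd d)
    (hfin : ∀ {ι : Type} [Fintype ι] (b : ι → ℝ) (t : ι → Rd d), ∑ i, b i = 1 →
      ∫⁻ f, ENNReal.ofReal (Real.exp (∑ i, b i * f (t i))) ∂μ ≠ ∞)
    (hinv : ∀ {ι : Type} [Fintype ι] (b : ι → ℝ) (t : ι → Rd d), ∑ i, b i = 1 →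
      ∫⁻ f, ENNReal.ofReal (Real.exp (∑ i, b i * f (t i + s))) ∂μ
        = ∫⁻ f, ENNReal.ofReal (Real.exp (∑ i, b i * f (t i))) ∂μ) :
    tiltedIncrements μ s = tiltedIncrements μ 0 := by
  have hfm : ∀ r, IsFiniteMeasure (tiltedIncrements μ r) := fun r => by
    refine ⟨?_⟩
    rw [← lintegral_one, lintegral_tiltedIncrements _ _ measurable_const]
    have := hfin (ι := Unit) (fun _ => 1) (fun _ => r) (by simp)
    simpa [lt_top_iff_ne_top] using this
  have := hfm s
  have := hfm 0
  -- Cramér–Wold: it suffices to compare the laws of linear functionals of finitely many increments.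
  refine ext_of_map_restrict fun I => Measure.ext_of_charFunDual (funext fun ℓ => ?_)
  have hI : Measurable fun (f : C(Rd d, ℝ)) (i : I) => f i :=
    measurable_pi_lambda _ fun i => measurable_eval _
  have hℓ : Measurable ℓ := ℓ.continuous.measurable
  rw [charFunDual_eq_charFun_map_one, charFunDual_eq_charFun_map_one]
  congr 1
  rw [Measure.map_map hℓ hI, Measure.map_map hℓ hI]
  let a : I → ℝ := fun i => ℓ (Pi.single i 1)
  have ha : ∀ x, ℓ x = ∑ i, a i * x i := fun x => by
    have := LinearMap.pi_apply_eq_sum_univ (ℓ : (I → ℝ) →ₗ[ℝ] ℝ) x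
    simp only [ContinuousLinearMap.coe_coe, smul_eq_mul] at this
    rw [this]
    refine Finset.sum_congr rfl fun i _ => ?_
    rw [mul_comm]
    congr 2
    ext j; simp [Pi.single_apply, eq_comm]
  -- The extra index is the base point: the density contributes weight `1` there and the subtracted
  -- values contribute `-z ∑ a_i`. The total weight is therefore one.
  let b : ℝ → Option I → ℝ := fun z o => o.elim (1 - ∑ i, z * a i) fun i => z * a i
  let t : Option I → Rd d := fun o => o.elim 0 fun i => i
  have hb : ∀ z, ∑ o, b z o = 1 := fun z => by simp [b, Fintype.sum_option]
  have key : ∀ z r, ∫⁻ x, ENNReal.ofReal (Real.exp (z * x))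
      ∂((tiltedIncrements μ r).map (ℓ ∘ fun f (i : I) => f i))
      = ∫⁻ f, ENNReal.ofReal (Real.exp (∑ o, b z o * f (t o + r))) ∂μ := fun z r => by
    have hm : Measurable fun x : ℝ => ENNReal.ofReal (Real.exp (z * x)) := by fun_prop
    rw [lintegral_map hm (hℓ.comp hI)]
    refine (lintegral_tiltedIncrements _ _ (hm.comp (hℓ.comp hI))).trans (lintegral_congr fun f => ?_)
    simp only [Function.comp]
    rw [← ENNReal.ofReal_mul (Real.exp_pos _).le, ← Real.exp_add, ha]
    congr 2
    simp only [Fintype.sum_option, b, t, Option.elim, increments_apply, zero_add, mul_sub,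
      Finset.sum_sub_distrib, sub_mul, one_mul, Finset.mul_sum, Finset.sum_mul, mul_assoc]
    ring
  refine ext_of_lintegral_exp (fun z => ?_) fun z => ?_
  · rw [key, key, hinv _ _ (hb z)]
    simp
  · rw [key, hinv _ _ (hb z)]
    exact hfin _ _ (hb z)

end Tilt

/-! ### Exponential moments of the drifted Gaussian field. -/

section GaussianField

variable {d : ℕ} {Ω : Type*} [MeasurableSpace Ω] {W : Ω → C(Rd d, ℝ)} {P : Measure Ω}

theorem lintegral_exp_of_hasGaussianLaw {U : Ω → ℝ} (hU : HasGaussianLaw U P) :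
    ∫⁻ ω, ENNReal.ofReal (Real.exp (U ω)) ∂P = ENNReal.ofReal (Real.exp (P[U] + Var[U; P] / 2)) := by
  have h := mgf_gaussianReal hU.map_eq_gaussianReal 1
  simp only [mgf, one_mul, mul_one, one_pow] at h
  have hint : Integrable (fun ω => Real.exp (U ω)) P := by
    -- A non-integrable function would have Bochner integral `0`, whereas the formula in `h` is
    -- positive.
    by_contra hn
    rw [integral_undef hn] at h
    exact (Real.exp_pos _).ne h
  rw [← ofReal_integral_eq_lintegral_ofReal hint (Eventually.of_forall fun ω => (Real.exp_pos _).le), h,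
    Real.coe_toNNReal _ (variance_nonneg _ _)]

namespace IsCentredGaussianField

theorem memLp_two (hW : IsCentredGaussianField W P) (t : Rd d) : MemLp (fun ω => W ω t) 2 P :=
  (hW.gaussian.hasGaussianLaw_eval t).memLp_two

theorem variance_sub_eq [IsProbabilityMeasure P] (hW : IsCentredGaussianField W P) (h x : Rd d) :
    Var[fun ω => W ω (x + h) - W ω x; P] = Var[fun ω => W ω h - W ω 0; P] := by
  have h1 := (hW.stationary h).2.2 0 x 0
  have h2 : ∀ y, AEMeasurable (fun ω => W ω (y + h) - W ω y) P := fun y =>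
    ((hW.memLp_two _).sub (hW.memLp_two _)).aemeasurable
  simp only [zero_add] at h1
  rw [covariance_self (h2 x)] at h1
  rw [h1]
  have := covariance_self (h2 0)
  simpa using this

theorem covariance_eq [IsProbabilityMeasure P] (hW : IsCentredGaussianField W P) (s t : Rd d) :
    cov[fun ω => W ω s, fun ω => W ω t; P] = (Var[fun ω => W ω s; P] + Var[fun ω => W ω t; P]
      - Var[fun ω => W ω (s - t) - W ω 0; P]) / 2 := by
  rw [← hW.variance_sub_eq (s - t) t, add_sub_cancel, variance_fun_sub (hW.memLp_two s) (hW.memLp_two t)]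
  ring

theorem hasGaussianLaw_sum (hW : IsCentredGaussianField W P) {ι : Type*} [Fintype ι] (b : ι → ℝ) (t : ι → Rd d) :
    HasGaussianLaw (fun ω => ∑ i, b i * W ω (t i)) P :=
  ((hW.gaussian.comp_right t).smul b).hasGaussianLaw_fun_sum

/-- Expand the covariances by polarisation. Since the weights sum to one, the double sums of
single-point variances collapse; the rest sees only differences of points. -/
theorem variance_sum [IsProbabilityMeasure P] (hW : IsCentredGaussianField W P) {ι : Type*} [Fintype ι] (b : ι → ℝ) (t : ι → Rd d) (hb : ∑ i, b i = 1) :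
    Var[fun ω => ∑ i, b i * W ω (t i); P] = ∑ i, b i * Var[fun ω => W ω (t i); P]
      - (∑ i, ∑ j, b i * b j * Var[fun ω => W ω (t i - t j) - W ω 0; P]) / 2 := by
  rw [variance_fun_sum fun i => (hW.memLp_two (t i)).const_mul (b i)]
  simp_rw [covariance_const_mul_left, covariance_const_mul_right, hW.covariance_eq]
  have h1 : ∀ i j, b i * (b j * ((Var[fun ω => W ω (t i); P] + Var[fun ω => W ω (t j); P]
      - Var[fun ω => W ω (t i - t j) - W ω 0; P]) / 2))
      = b i * Var[fun ω => W ω (t i); P] / 2 * b j + b i * (b j * Var[fun ω => W ω (t j); P] / 2)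
        - b i * b j * Var[fun ω => W ω (t i - t j) - W ω 0; P] / 2 := fun i j => by ring
  simp_rw [h1, Finset.sum_sub_distrib, Finset.sum_add_distrib, ← Finset.mul_sum, ← Finset.sum_mul, hb,
    one_mul, mul_one, ← Finset.sum_div]
  ring

/-- The drift `-σ²/2` cancels exactly the non-stationary part of half the variance, leaving a
shift-invariant expression. -/
theorem lintegral_exp_sum [IsProbabilityMeasure P] (hW : IsCentredGaussianField W P) {ι : Type*} [Fintype ι] (b : ι → ℝ) (t : ι → Rd d) (hb : ∑ i, b i = 1) :
    ∫⁻ ω, ENNReal.ofReal (Real.exp (∑ i, b i * driftedPath hW.sigmaSq (W ω) (t i))) ∂P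
      = ENNReal.ofReal (Real.exp
        (-(∑ i, ∑ j, b i * b j * Var[fun ω => W ω (t i - t j) - W ω 0; P]) / 4)) := by
  have h1 : ∀ ω, ENNReal.ofReal (Real.exp (∑ i, b i * driftedPath hW.sigmaSq (W ω) (t i)))
      = ENNReal.ofReal (Real.exp (∑ i, b i * W ω (t i)))
        * ENNReal.ofReal (Real.exp (-(∑ i, b i * Var[fun ω => W ω (t i); P]) / 2)) := fun ω => by
    rw [← ENNReal.ofReal_mul (Real.exp_pos _).le, ← Real.exp_add]
    congr 2
    simp only [driftedPath, sigmaSq, ContinuousMap.coe_mk, mul_sub, Finset.sum_sub_distrib, neg_div,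
      Finset.sum_div, mul_div_assoc]
    rw [sub_eq_add_neg]
  have h0 : ∫ ω, ∑ i, b i * W ω (t i) ∂P = 0 := by
    rw [integral_finsetSum _ fun i _ => ((hW.memLp_two (t i)).integrable (by norm_num)).const_mul _]
    simp [integral_const_mul, hW.mean_zero]
  have hU := hW.hasGaussianLaw_sum b t
  simp_rw [h1]
  rw [lintegral_mul_const' _ _ ENNReal.ofReal_ne_top, lintegral_exp_of_hasGaussianLaw hU, h0,
    hW.variance_sum b t hb, ← ENNReal.ofReal_mul (Real.exp_pos _).le, ← Real.exp_add]
  congr 2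
  ring

theorem aemeasurable_driftedPath [IsProbabilityMeasure P] (hW : IsCentredGaussianField W P) : AEMeasurable (fun ω => driftedPath hW.sigmaSq (W ω)) P :=
  (measurable_path fun t => (measurable_eval t).sub_const _ :
    Measurable (driftedPath hW.sigmaSq)).comp_aemeasurable hW.aemeasurable

/-- The law of the drifted field, tilted by its value at `s` and seen from `s`, does not depend
on `s`. -/
theorem tiltedIncrements_map_eq [IsProbabilityMeasure P] (hW : IsCentredGaussianField W P) (s : Rd d) :
    tiltedIncrements (P.map fun ω => driftedPath hW.sigmaSq (W ω)) s
      = tiltedIncrements (P.map fun ω => driftedPath hW.sigmaSq (W ω)) 0 := by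
  have key : ∀ {ι : Type} [Fintype ι] (b : ι → ℝ) (t : ι → Rd d), ∑ i, b i = 1 →
      ∫⁻ f, ENNReal.ofReal (Real.exp (∑ i, b i * f (t i))) ∂P.map (fun ω => driftedPath hW.sigmaSq (W ω))
        = ENNReal.ofReal (Real.exp
          (-(∑ i, ∑ j, b i * b j * Var[fun ω => W ω (t i - t j) - W ω 0; P]) / 4)) := by
    intro ι _ b t hb
    have hm : Measurable fun f : C(Rd d, ℝ) => ENNReal.ofReal (Real.exp (∑ i, b i * f (t i))) :=
      (Real.measurable_exp.comp (Finset.measurable_fun_sum _ fun i _ =>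
        (measurable_eval (t i)).const_mul _)).ennreal_ofReal
    rw [lintegral_map' hm.aemeasurable hW.aemeasurable_driftedPath, hW.lintegral_exp_sum b t hb]
  refine tiltedIncrements_eq s (fun b t hb => ?_) fun b t hb => ?_
  · rw [key b t hb]; exact ENNReal.ofReal_ne_top
  · rw [key b t hb, key b _ hb]
    simp

end IsCentredGaussianField

end GaussianField

/-! ### Exponential moments of the supremum over a compact set. -/

section Fernique

/-- A bound for the exponential moment of the norm of a centred Gaussian vector, uniform over
all vectors whose norm is at most `a` with probability at least `3/4`. -/
theorem exists_lintegral_exp_norm_le (a : ℝ) (ha : 0 < a) :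
    ∃ C : ℝ≥0∞, C ≠ ∞ ∧ ∀ (E : Type) [NormedAddCommGroup E] [NormedSpace ℝ E] [CompleteSpace E]
      [SecondCountableTopology E] [MeasurableSpace E] [BorelSpace E] (μ : Measure E) [IsGaussian μ],
      μ[id] = 0 → ENNReal.ofReal (3 / 4) ≤ μ {x | ‖x‖ ≤ a} →
      ∫⁻ x, ENNReal.ofReal (Real.exp ‖x‖) ∂μ ≤ C := by
  -- Fernique's argument needs a probability above `1/2`. With `3/4` the ratio `c / (1 - c)` is `3`,
  -- and all constants depend on `a` alone, not on the space.
  set c : ℝ≥0∞ := ENNReal.ofReal (3 / 4) with hc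
  have hc1 : 1 - c = ENNReal.ofReal (1 / 4) := by
    rw [hc, ← ENNReal.ofReal_one, ← ENNReal.ofReal_sub _ (by norm_num)]
    norm_num
  have hgt : (2 : ℝ≥0∞)⁻¹ < c := by
    have : (2 : ℝ≥0∞)⁻¹ = ENNReal.ofReal (1 / 2) := by
      rw [one_div, ENNReal.ofReal_inv_of_pos (by norm_num)]; norm_num
    rw [this, hc, ENNReal.ofReal_lt_ofReal_iff (by norm_num)]
    norm_num
  have hlt : c < 1 := by
    rw [hc, ← ENNReal.ofReal_one, ENNReal.ofReal_lt_ofReal_iff (by norm_num)]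
    norm_num
  have hq : (c / (1 - c)).toReal = 3 := by
    rw [hc1, ENNReal.toReal_div, hc, ENNReal.toReal_ofReal (by norm_num),
      ENNReal.toReal_ofReal (by norm_num)]
    norm_num
  set δ : ℝ := Fernique.logRatio c * a⁻¹ ^ 2 with hδ
  have hδ0 : 0 < δ := mul_pos (Fernique.logRatio_pos hgt hlt) (by positivity)
  set S : ℝ≥0∞ := ENNReal.ofReal (Real.exp (Fernique.logRatio c))
    + ∑' n : ℕ, ENNReal.ofReal (Real.exp (-2⁻¹ * Real.log (c / (1 - c)).toReal * 2 ^ n)) with hS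
  have hSfin : S ≠ ∞ := by
    refine (ENNReal.add_lt_top.mpr ⟨ENNReal.ofReal_lt_top, ?_⟩).ne
    refine Summable.tsum_ofReal_lt_top <|
      Real.summable_exp_nat_mul_of_ge ?_ (fun i ↦ mod_cast (Nat.lt_pow_self (by simp)).le)
    rw [hq]
    exact mul_neg_of_neg_of_pos (by simp) (Real.log_pos (by norm_num))
  refine ⟨ENNReal.ofReal (Real.exp (1 / (4 * δ))) * S,
    ENNReal.mul_ne_top ENNReal.ofReal_ne_top hSfin, ?_⟩
  intro E _ _ _ _ _ _ μ _ h0 hμ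
  have hrot := IsGaussian.map_rotation_eq_self h0 (-(Real.pi / 4))
  have hF := lintegral_exp_mul_sq_norm_le_of_map_rotation_eq_self hrot hμ hgt
  calc ∫⁻ x, ENNReal.ofReal (Real.exp ‖x‖) ∂μ
      ≤ ∫⁻ x, ENNReal.ofReal (Real.exp (1 / (4 * δ))) * ENNReal.ofReal (Real.exp (δ * ‖x‖ ^ 2)) ∂μ := by
        refine lintegral_mono fun x => ?_
        rw [← ENNReal.ofReal_mul (Real.exp_pos _).le, ← Real.exp_add]
        refine ENNReal.ofReal_le_ofReal (Real.exp_le_exp.2 ?_)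
        -- Completing the square bounds `‖x‖` by Fernique's exponent `δ‖x‖²` plus a constant.
        have h1 : 1 / (4 * δ) + δ * ‖x‖ ^ 2 - ‖x‖ = (2 * δ * ‖x‖ - 1) ^ 2 / (4 * δ) := by
          field_simp; ring
        have h2 : 0 ≤ (2 * δ * ‖x‖ - 1) ^ 2 / (4 * δ) := by positivity
        linarith
    _ ≤ ENNReal.ofReal (Real.exp (1 / (4 * δ))) * S := by
        rw [lintegral_const_mul' _ _ ENNReal.ofReal_ne_top]
        gcongr

variable {d : ℕ} {Ω : Type*} [MeasurableSpace Ω] {W : Ω → C(Rd d, ℝ)} {P : Measure Ω}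

/-- Paths are bounded on `K`, so one level bounds the field on `K` with probability at least `3/4`.
It serves every finite `J ⊆ K`, whence a bound uniform in `J`. -/
theorem IsCentredGaussianField.lintegral_exp_restrict_le [IsProbabilityMeasure P]
    (hW : IsCentredGaussianField W P) {K : Set (Rd d)} (hK : IsCompact K) :
    ∃ C : ℝ≥0∞, C ≠ ∞ ∧ ∀ J : Finset (Rd d), (J : Set (Rd d)) ⊆ K →
      ∫⁻ ω, ENNReal.ofReal (Real.exp ‖fun t : J => W ω t‖) ∂P ≤ C := by
  let B : ℕ → Set Ω := fun n => {ω | ∀ t ∈ K, |W ω t| ≤ n + 1}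
  have hBm : Monotone B := fun n m h ω hω t ht => (hω t ht).trans (by gcongr)
  have hBu : ⋃ n, B n = Set.univ := by
    refine Set.eq_univ_of_forall fun ω => ?_
    obtain ⟨r, hr⟩ := hK.exists_bound_of_continuousOn (W ω).continuous.continuousOn
    obtain ⟨n, hn⟩ := exists_nat_ge r
    refine Set.mem_iUnion.2 ⟨n, fun t ht => ?_⟩
    have := hr t ht
    rw [Real.norm_eq_abs] at this
    linarith
  -- Continuity from below needs no measurability of the sets `B n`.
  have hlim := tendsto_measure_iUnion_atTop (μ := P) hBm
  rw [hBu, measure_univ] at hlim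
  have h34 : ENNReal.ofReal (3 / 4) < 1 := by
    rw [← ENNReal.ofReal_one, ENNReal.ofReal_lt_ofReal_iff (by norm_num)]
    norm_num
  obtain ⟨n, hn⟩ := (hlim.eventually (lt_mem_nhds h34)).exists
  obtain ⟨C, hC, h⟩ := exists_lintegral_exp_norm_le (n + 1) (by positivity)
  refine ⟨C, hC, fun J hJ => ?_⟩
  have hG := hW.gaussian.hasGaussianLaw J
  have hm : AEMeasurable (fun ω (t : J) => W ω t) P :=
    aemeasurable_pi_lambda _ fun t => hW.gaussian.aemeasurable t
  have hμ : IsGaussian (P.map fun ω (t : J) => W ω t) := hG.isGaussian_map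
  have hexp : Measurable fun x : J → ℝ => ENNReal.ofReal (Real.exp ‖x‖) := by fun_prop
  have key := h (J → ℝ) (P.map fun ω (t : J) => W ω t) ?_ ?_
  · rwa [lintegral_map' hexp.aemeasurable hm] at key
  · rw [integral_map hm aestronglyMeasurable_id]
    ext t
    simp only [id]
    rw [eval_integral fun i : J => (hW.memLp_two (i : Rd d)).integrable (by norm_num)]
    exact hW.mean_zero t
  · rw [Measure.map_apply_of_aemeasurable hm (measurableSet_le measurable_norm measurable_const)]
    refine hn.le.trans (measure_mono fun ω hω => ?_)
    exact (pi_norm_le_iff_of_nonneg (by positivity)).2 fun t => hω t (hJ t.2)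

/-- The supremum of the field over a compact set has an exponential moment. -/
theorem IsCentredGaussianField.exists_lintegral_ne_top [IsProbabilityMeasure P]
    (hW : IsCentredGaussianField W P) {K : Set (Rd d)} (hK : IsCompact K) :
    ∃ g : Ω → ℝ≥0∞, (∀ ω, ∀ t ∈ K, ENNReal.ofReal (Real.exp (W ω t)) ≤ g ω) ∧ ∫⁻ ω, g ω ∂P ≠ ∞ := by
  classical
  obtain ⟨C, hC, h⟩ := hW.lintegral_exp_restrict_le hK
  obtain ⟨v, hvK, hv, hKv⟩ :=
    (TopologicalSpace.IsSeparable.of_separableSpace K).exists_countable_dense_subset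
  rcases K.eq_empty_or_nonempty with rfl | hne
  · exact ⟨0, by simp, by simp⟩
  have hvne : v.Nonempty := by
    rw [← closure_nonempty_iff]; exact hne.mono hKv
  obtain ⟨u, rfl⟩ := hv.exists_eq_range hvne
  let J : ℕ → Finset (Rd d) := fun n => (Finset.range n).image u
  have hJK : ∀ n, (J n : Set (Rd d)) ⊆ K := fun n t ht => by
    obtain ⟨i, -, rfl⟩ := Finset.mem_image.1 (Finset.mem_coe.1 ht)
    exact hvK ⟨i, rfl⟩
  -- These increase along a dense sequence in `K`, so monotone convergence carries the uniform bound
  -- to their supremum.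
  let G : ℕ → Ω → ℝ≥0∞ := fun n ω => ENNReal.ofReal (Real.exp ‖fun t : J n => W ω t‖)
  have hGm : ∀ n, AEMeasurable (G n) P := fun n =>
    (Real.measurable_exp.comp measurable_norm).ennreal_ofReal.comp_aemeasurable
      (aemeasurable_pi_lambda _ fun t => hW.gaussian.aemeasurable t)
  have hmono : ∀ ω, Monotone fun n => G n ω := fun ω n m hnm => by
    refine ENNReal.ofReal_le_ofReal (Real.exp_le_exp.2 ?_)
    refine (pi_norm_le_iff_of_nonneg (norm_nonneg _)).2 fun t => ?_
    have ht : (t : Rd d) ∈ J m :=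
      Finset.image_subset_image (Finset.range_mono hnm) t.2
    exact norm_le_pi_norm (fun t : J m => W ω t) ⟨t, ht⟩
  refine ⟨fun ω => ⨆ n, G n ω, fun ω => ?_, ?_⟩
  · have hcl : IsClosed {t | ENNReal.ofReal (Real.exp (W ω t)) ≤ ⨆ n, G n ω} :=
      isClosed_le (ENNReal.continuous_ofReal.comp (Real.continuous_exp.comp (W ω).continuous))
        continuous_const
    refine fun t ht => closure_minimal ?_ hcl (hKv ht)
    rintro _ ⟨i, rfl⟩
    refine le_trans ?_ (le_iSup (fun n => G n ω) (i + 1))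
    refine ENNReal.ofReal_le_ofReal (Real.exp_le_exp.2 ((le_abs_self _).trans ?_))
    have hi : u i ∈ J (i + 1) := Finset.mem_image.2 ⟨i, by simp, rfl⟩
    exact norm_le_pi_norm (fun t : J (i + 1) => W ω t) ⟨u i, hi⟩
  · rw [lintegral_iSup' hGm (Eventually.of_forall hmono)]
    exact ((iSup_le fun n => h (J n) (hJK n)).trans_lt hC.lt_top).ne

end Fernique

/-! ### Shifting the measure `e^{-x} dx`. -/

section ExpIntensity

instance : IsLocallyFiniteMeasure expIntensity :=
  IsLocallyFiniteMeasure.withDensity_ofReal (by fun_prop)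

instance : SFinite expIntensity := by unfold expIntensity; infer_instance

theorem lintegral_comp_add_expIntensity {g : ℝ → ℝ≥0∞} (hg : Measurable g) (m : ℝ) :
    ∫⁻ x, g (x + m) ∂expIntensity = ENNReal.ofReal (Real.exp m) * ∫⁻ y, g y ∂expIntensity := by
  have he : Measurable fun x : ℝ => ENNReal.ofReal (Real.exp (-x)) := by fun_prop
  have h1 := lintegral_withDensity_eq_lintegral_mul (volume : Measure ℝ) he
    (hg.comp (measurable_add_const m))
  have h2 := lintegral_withDensity_eq_lintegral_mul (volume : Measure ℝ) he hg
  unfold expIntensity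
  refine h1.trans ?_
  rw [h2, ← lintegral_const_mul' _ _ ENNReal.ofReal_ne_top,
    ← lintegral_add_right_eq_self (fun y => _ * _) m]
  refine lintegral_congr fun x => ?_
  simp only [Pi.mul_apply, Function.comp]
  rw [← mul_assoc, ← ENNReal.ofReal_mul (Real.exp_pos _).le, ← Real.exp_add]
  congr 3
  ring

end ExpIntensity

/-! ### Unit cubes and lattice cells. -/

section Cells

variable {d : ℕ}

/-- The cells of the integer lattice. -/
def cell (k : Fin d → ℤ) : Set (Rd d) := {t | ∀ i, ⌊t i⌋ = k i}

/-- The open unit cube. -/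
def openCube (d : ℕ) : Set (Rd d) := {t | ∀ i, 0 < t i ∧ t i < 1}

/-- The closed unit cube. -/
def closedCube (d : ℕ) : Set (Rd d) := {t | ∀ i, 0 ≤ t i ∧ t i ≤ 1}

theorem measurableSet_cell (k : Fin d → ℤ) : MeasurableSet (cell k) := by
  have : cell k = ⋂ i, (fun t : Rd d => ⌊t i⌋) ⁻¹' {k i} := by ext; simp [cell]
  rw [this]
  exact MeasurableSet.iInter fun i =>
    (Int.measurable_floor.comp (by fun_prop)) (measurableSet_singleton _)

theorem isOpen_openCube : IsOpen (openCube d) := by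
  have : openCube d = ⋂ i, ({t : Rd d | 0 < t i} ∩ {t | t i < 1}) := by ext; simp [openCube]
  rw [this]
  exact isOpen_iInter_of_finite fun i =>
    (isOpen_lt continuous_const (by fun_prop)).inter (isOpen_lt (by fun_prop) continuous_const)

theorem openCube_nonempty : (openCube d).Nonempty :=
  ⟨WithLp.toLp 2 fun _ => 1 / 2, fun i => by norm_num⟩

theorem openCube_subset_cell : openCube d ⊆ cell 0 := fun t ht i => by
  simp only [Pi.zero_apply, Int.floor_eq_zero_iff, Set.mem_Ico]
  exact ⟨(ht i).1.le, (ht i).2⟩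

theorem isCompact_closedCube : IsCompact (closedCube d) := by
  have : closedCube d = WithLp.toLp 2 '' Set.Icc (0 : Fin d → ℝ) 1 := by
    ext t
    simp only [closedCube, Set.mem_image, Set.mem_Icc, Pi.le_def]
    constructor
    · intro h
      exact ⟨WithLp.ofLp t, ⟨fun i => (h i).1, fun i => (h i).2⟩, rfl⟩
    · rintro ⟨x, hx, rfl⟩ i
      exact ⟨hx.1 i, hx.2 i⟩
  rw [this]
  exact isCompact_Icc.image (PiLp.continuous_toLp 2 _)

theorem closedCube_nonempty : (closedCube d).Nonempty := ⟨0, fun i => by simp⟩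

theorem openCube_subset_closedCube : openCube d ⊆ closedCube d := fun _ ht i =>
  ⟨(ht i).1.le, (ht i).2.le⟩

end Cells

/-! ### The joint intensity of positions and shapes. -/

section Intensity

variable {d : ℕ} {μ : Measure C(Rd d, ℝ)}

/-- The weight `e^{M(f)}`. -/
noncomputable def expSup (f : C(Rd d, ℝ)) : ℝ≥0∞ := ENNReal.ofReal (Real.exp (pathSup f))

theorem measurable_expSup : Measurable (expSup : C(Rd d, ℝ) → ℝ≥0∞) :=
  (Real.measurable_exp.comp measurable_pathSup).ennreal_ofReal

theorem expSup_ne_zero (f : C(Rd d, ℝ)) : expSup f ≠ 0 := by simp [expSup, Real.exp_pos]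

/-- Because `e^{M(f)} = e^{f(s)} e^{M(increments s f)}`, the left side is an integral against the
tilted increments from `s`, whose law does not depend on `s`. -/
theorem lintegral_expSup_mul_increments (hco : ∀ᵐ f ∂μ, f ∈ coercivePaths d)
    (hμ : ∀ s, tiltedIncrements μ s = tiltedIncrements μ 0) {H : C(Rd d, ℝ) → ℝ≥0∞}
    (hH : Measurable H) (s : Rd d) :
    ∫⁻ f, expSup f * H (increments s f) ∂μ = ∫⁻ f, expSup f * H (increments 0 f) ∂μ := by
  have key : ∀ r, ∫⁻ f, expSup f * H (increments r f) ∂μ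
      = ∫⁻ f, expSup f * H f ∂tiltedIncrements μ r := fun r => by
    refine Eq.trans (lintegral_congr_ae ?_)
      (lintegral_tiltedIncrements _ _ (measurable_expSup.mul hH)).symm
    filter_upwards [hco] with f hf
    rw [Pi.mul_apply, ← mul_assoc, expSup, expSup, pathSup_increments hf, ← ENNReal.ofReal_mul (Real.exp_pos _).le,
      ← Real.exp_add, add_sub_cancel]
  rw [key, key, hμ s]

/-- The measure `E[e^M; (T, F) ∈ ·]`. -/
noncomputable def markIntensity (μ : Measure C(Rd d, ℝ)) : Measure (Rd d × C(Rd d, ℝ)) :=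
  (μ.withDensity expSup).map fun f => (argsupInf' f, recentred' f)

theorem measurable_argsupInf'_recentred' :
    Measurable fun f : C(Rd d, ℝ) => (argsupInf' f, recentred' f) :=
  measurable_argsupInf'.prodMk measurable_recentred'

theorem lintegral_markIntensity {G : Rd d × C(Rd d, ℝ) → ℝ≥0∞} (hG : Measurable G) :
    ∫⁻ z, G z ∂markIntensity μ = ∫⁻ f, expSup f * G (argsupInf' f, recentred' f) ∂μ := by
  rw [markIntensity, lintegral_map hG measurable_argsupInf'_recentred']
  exact lintegral_withDensity_eq_lintegral_mul _ measurable_expSup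
    (hG.comp measurable_argsupInf'_recentred')

theorem lintegral_markIntensity_sub (hco : ∀ᵐ f ∂μ, f ∈ coercivePaths d)
    (hμ : ∀ s, tiltedIncrements μ s = tiltedIncrements μ 0) {G : Rd d × C(Rd d, ℝ) → ℝ≥0∞}
    (hG : Measurable G) (s : Rd d) :
    ∫⁻ z, G (z.1 - s, z.2) ∂markIntensity μ = ∫⁻ z, G z ∂markIntensity μ := by
  have hGs : Measurable fun z : Rd d × C(Rd d, ℝ) => G (z.1 - s, z.2) :=
    hG.comp ((measurable_fst.sub_const s).prodMk measurable_snd)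
  have h := lintegral_expSup_mul_increments hco hμ (hG.comp measurable_argsupInf'_recentred') s
  rw [lintegral_markIntensity hGs, lintegral_markIntensity hG]
  refine Eq.trans (lintegral_congr_ae ?_) (h.trans (lintegral_congr_ae ?_))
  all_goals
    filter_upwards [hco] with f hf
    simp [argsupInf'_increments hf, recentred'_increments hf]

/-- The paths that attain their supremum in `K`. -/
def hitting (K : Set (Rd d)) : Set C(Rd d, ℝ) := {f ∈ coercivePaths d | (argsup f ∩ K).Nonempty}

/-- Mass transport. If `T` lies in cell `0`, choose a maximiser and let `k` be its cell. Shifting by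
`k` puts the maximiser in the closed unit cube and `T` in cell `-k`. Each shift preserves the
weighted integral, and summing over the disjoint cells `-k` leaves at most the weight `e^M` on paths
maximised in the cube. -/
theorem markIntensity_cell_ne_top (hco : ∀ᵐ f ∂μ, f ∈ coercivePaths d)
    (hμ : ∀ s, tiltedIncrements μ s = tiltedIncrements μ 0)
    (hfin : ∫⁻ f in hitting (closedCube d), expSup f ∂μ ≠ ∞) :
    markIntensity μ (cell 0 ×ˢ Set.univ) ≠ ∞ := by
  classical
  have hh : MeasurableSet (hitting (closedCube d)) :=
    measurableSet_inter_argsup_nonempty isCompact_closedCube.isClosed closedCube_nonempty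
  let H : (Fin d → ℤ) → C(Rd d, ℝ) → ℝ≥0∞ := fun k =>
    (argsupInf' ⁻¹' cell (-k) ∩ hitting (closedCube d)).indicator 1
  have hHm : ∀ k, Measurable (H k) := fun k =>
    measurable_one.indicator ((measurable_argsupInf' (measurableSet_cell _)).inter hh)
  let v : (Fin d → ℤ) → Rd d := fun k => WithLp.toLp 2 fun i => (k i : ℝ)
  have h1 : ∀ f ∈ coercivePaths d, (argsupInf' ⁻¹' cell 0).indicator 1 f
      ≤ ∑' k, H k (increments (v k) f) := by
    intro f hf
    by_cases h0 : f ∈ argsupInf' ⁻¹' cell 0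
    swap
    · rw [Set.indicator_of_notMem h0]; exact zero_le
    rw [Set.indicator_of_mem h0]
    obtain ⟨t, ht⟩ := argsup_nonempty hf
    let k : Fin d → ℤ := fun i => ⌊t i⌋
    have hmem : increments (v k) f ∈ argsupInf' ⁻¹' cell (-k) ∩ hitting (closedCube d) := by
      refine ⟨fun i => ?_, increments_mem_coercivePaths hf _, t - v k,
        mem_argsup_increments.2 (by simpa using ht), fun i => ?_⟩
      · have : ⌊argsupInf' f i⌋ = 0 := h0 i
        simp [argsupInf'_increments hf, v, this]
      · have h2 := Int.floor_le (t i)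
        have h3 := Int.lt_floor_add_one (t i)
        simp only [PiLp.sub_apply, v, k]
        constructor <;> linarith
    refine le_trans (le_of_eq ?_) (ENNReal.le_tsum k)
    exact (Set.indicator_of_mem hmem 1).symm
  have h2 : ∀ f, ∑' k, H k f ≤ (hitting (closedCube d)).indicator 1 f := by
    intro f
    by_cases hf : f ∈ hitting (closedCube d)
    · rw [tsum_eq_single (fun i => -⌊argsupInf' f i⌋), Set.indicator_of_mem hf]
      · exact Set.indicator_le_self' (fun _ _ => zero_le) f
      · intro k hk
        refine Set.indicator_of_notMem (fun hm => hk ?_) _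
        ext i
        have : ⌊argsupInf' f i⌋ = (-k) i := hm.1 i
        simp [this]
    · have : ∀ k, H k f = 0 := fun k => Set.indicator_of_notMem (fun h => hf h.2) _
      simp [this]
  have h3 : markIntensity μ (cell 0 ×ˢ Set.univ)
      = ∫⁻ f, expSup f * (argsupInf' ⁻¹' cell 0).indicator 1 f ∂μ := by
    have hm : MeasurableSet (cell (0 : Fin d → ℤ) ×ˢ (Set.univ : Set C(Rd d, ℝ))) :=
      (measurableSet_cell 0).prod MeasurableSet.univ
    rw [← lintegral_indicator_one hm, lintegral_markIntensity (measurable_one.indicator hm)]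
    refine lintegral_congr fun f => ?_
    simp [Set.indicator_apply]
  have hm : ∀ k s, AEMeasurable (fun f => expSup f * H k (increments s f)) μ := fun k s =>
    (measurable_expSup.mul ((hHm k).comp (measurable_increments s))).aemeasurable
  refine ne_top_of_le_ne_top hfin ?_
  calc markIntensity μ (cell 0 ×ˢ Set.univ)
      ≤ ∫⁻ f, ∑' k, expSup f * H k (increments (v k) f) ∂μ := by
        rw [h3]
        refine lintegral_mono_ae ?_
        filter_upwards [hco] with f hf
        rw [ENNReal.tsum_mul_left]
        gcongr
        exact h1 f hf
    _ = ∑' k, ∫⁻ f, expSup f * H k (increments 0 f) ∂μ := by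
        rw [lintegral_tsum fun k => hm k _]
        exact tsum_congr fun k => lintegral_expSup_mul_increments hco hμ (hHm k) _
    _ = ∫⁻ f, expSup f * ∑' k, H k (increments 0 f) ∂μ := by
        rw [← lintegral_tsum fun k => hm k _]
        simp_rw [ENNReal.tsum_mul_left]
    _ ≤ ∫⁻ f, (hitting (closedCube d)).indicator expSup f ∂μ := by
        refine lintegral_mono_ae ?_
        filter_upwards [hco] with f hf
        refine (mul_le_mul_right (h2 _) _).trans ?_
        by_cases h : f ∈ hitting (closedCube d)
        · rw [Set.indicator_of_mem h]
          exact mul_le_of_le_one_right zero_le (Set.indicator_le_self' (fun _ _ => zero_le) _)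
        · have : increments 0 f ∉ hitting (closedCube d) := fun hi => h ⟨hf, by
            obtain ⟨t, ht, htc⟩ := hi.2
            exact ⟨t, by simpa using mem_argsup_increments.1 ht, htc⟩⟩
          simp [this]
    _ = ∫⁻ f in hitting (closedCube d), expSup f ∂μ := lintegral_indicator hh _

/-- The measure `E[e^M; (T, F) ∈ ·]` is the product of a multiple of the Lebesgue measure and a
probability measure. -/
theorem exists_markIntensity_eq_prod [NeZero μ] (hco : ∀ᵐ f ∂μ, f ∈ coercivePaths d)
    (hμ : ∀ s, tiltedIncrements μ s = tiltedIncrements μ 0)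
    (hfin : ∫⁻ f in hitting (closedCube d), expSup f ∂μ ≠ ∞) :
    ∃ (lam : ℝ≥0) (Q : Measure C(Rd d, ℝ)), 0 < lam ∧ IsProbabilityMeasure Q ∧
      markIntensity μ = (lam • (volume : Measure (Rd d))).prod Q := by
  set κ := markIntensity μ with hκ
  have hU := isOpen_openCube (d := d)
  have hκU : κ (openCube d ×ˢ Set.univ) ≠ ∞ :=
    ne_top_of_le_ne_top (markIntensity_cell_ne_top hco hμ hfin)
      (measure_mono (Set.prod_mono_left openCube_subset_cell))
  let ρ : Set C(Rd d, ℝ) → Measure (Rd d) := fun D => (κ.restrict (Prod.snd ⁻¹' D)).map Prod.fst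
  have hρ : ∀ D B, MeasurableSet B → ρ D B = κ (B ×ˢ D) := fun D B hB => by
    rw [Measure.map_apply measurable_fst hB, Measure.restrict_apply (measurable_fst hB)]
    rfl
  have hc : ∀ D, MeasurableSet D → ∃ c : ℝ≥0, ∀ B, MeasurableSet B → κ (B ×ˢ D) = c * volume B := by
    intro D hD
    -- Fixing the shape set `D` leaves a translation-invariant measure in the position, hence a
    -- multiple of Lebesgue measure.
    have hinv : (ρ D).IsAddLeftInvariant := ⟨fun g => by
      ext B hB
      have hBg : MeasurableSet ((fun x => g + x) ⁻¹' B) := measurable_const_add g hB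
      rw [Measure.map_apply (measurable_const_add g) hB, hρ _ _ hBg, hρ _ _ hB,
        ← lintegral_indicator_one (hBg.prod hD), ← lintegral_indicator_one (hB.prod hD),
        ← lintegral_markIntensity_sub hco hμ (measurable_one.indicator (hB.prod hD)) (-g)]
      refine lintegral_congr fun z => ?_
      rw [sub_neg_eq_add, add_comm]
      rfl⟩
    have hfc : IsFiniteMeasureOnCompacts (ρ D) := ⟨fun K hK =>
      measure_lt_top_of_isCompact_of_isAddLeftInvariant (openCube d) hU openCube_nonempty
        (by rw [hρ _ _ hU.measurableSet]
            exact ne_top_of_le_ne_top hκU (measure_mono (Set.prod_mono_right (Set.subset_univ _)))) hK⟩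
    refine ⟨Measure.addHaarScalarFactor (ρ D) volume, fun B hB => ?_⟩
    rw [← hρ _ _ hB]
    conv_lhs => rw [Measure.isAddLeftInvariant_eq_smul (ρ D) volume]
    rfl
  have hv0 : volume (openCube d) ≠ 0 := (hU.measure_pos volume openCube_nonempty).ne'
  have hv1 : volume (openCube d) ≠ ∞ :=
    ne_top_of_le_ne_top isCompact_closedCube.measure_lt_top.ne (measure_mono openCube_subset_closedCube)
  obtain ⟨lam, hlam⟩ := hc Set.univ MeasurableSet.univ
  -- The weight `e^M` is strictly positive and `μ` is nonzero, so the intensity cannot vanish.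
  have hlam0 : lam ≠ 0 := by
    rintro rfl
    have h0 : κ Set.univ = 0 := by simpa using hlam Set.univ MeasurableSet.univ
    rw [← lintegral_one, lintegral_markIntensity measurable_const,
      lintegral_eq_zero_iff (measurable_expSup.mul_const _)] at h0
    have : ∀ᵐ f ∂μ, False := by
      filter_upwards [h0] with f hf
      exact expSup_ne_zero f (by simpa using hf)
    simp only [ae_iff, not_false_eq_true, Set.ofPred_true] at this
    exact NeZero.ne μ (Measure.measure_univ_eq_zero.1 this)
  have hlamU := hlam _ hU.measurableSet
  have hm0 : κ (openCube d ×ˢ Set.univ) ≠ 0 := by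
    rw [hlamU]; exact mul_ne_zero (by simpa using hlam0) hv0
  -- `Q` is the normalised shape law for positions in the open cube; by proportionality to Lebesgue
  -- measure, this choice determines all rectangles.
  let Q : Measure C(Rd d, ℝ) :=
    (κ (openCube d ×ˢ Set.univ))⁻¹ • (κ.restrict (Prod.fst ⁻¹' openCube d)).map Prod.snd
  have hQ : ∀ D, MeasurableSet D → Q D
      = (κ (openCube d ×ˢ Set.univ))⁻¹ * κ (openCube d ×ˢ D) := fun D hD => by
    rw [Measure.smul_apply, Measure.map_apply measurable_snd hD,
      Measure.restrict_apply (measurable_snd hD), smul_eq_mul, Set.inter_comm]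
    rfl
  have hQp : IsProbabilityMeasure Q := ⟨by
    rw [hQ _ MeasurableSet.univ, ENNReal.inv_mul_cancel hm0 hκU]⟩
  refine ⟨lam, Q, pos_iff_ne_zero.2 hlam0, hQp, (Measure.prod_eq fun B D hB hD => ?_).symm⟩
  obtain ⟨c, hcD⟩ := hc D hD
  rw [hQ D hD, hcD _ hB, hcD _ hU.measurableSet, hlamU, Measure.smul_apply, ENNReal.smul_def, smul_eq_mul,
    ENNReal.mul_inv (Or.inr hv1) (Or.inr hv0)]
  have hl0 : (lam : ℝ≥0∞) ≠ 0 := by simpa using hlam0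
  calc (c : ℝ≥0∞) * volume B = c * volume B * ((lam : ℝ≥0∞) * (lam : ℝ≥0∞)⁻¹)
        * (volume (openCube d) * (volume (openCube d))⁻¹) := by
        rw [ENNReal.mul_inv_cancel hl0 ENNReal.coe_ne_top, ENNReal.mul_inv_cancel hv0 hv1]; simp
    _ = _ := by ring

end Intensity

/-! ### Image of the marked intensity, and conclusion. -/

variable {d : ℕ} {Ω : Type*} [MeasurableSpace Ω] {W : Ω → C(Rd d, ℝ)} {P : Measure Ω}
  [IsProbabilityMeasure P]

theorem measurable_driftedPath (s : C(Rd d, ℝ)) : Measurable (driftedPath s) :=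
  measurable_path fun t => (measurable_eval t).sub_const _

/-- At a maximiser `t ∈ K` one has `M = W(t) - σ²(t)/2 ≤ W(t)`, so the integrable bound for `e^W` on
`K` dominates `e^M`. -/
theorem IsCentredGaussianField.lintegral_hitting_expSup_ne_top (hW : IsCentredGaussianField W P)
    {K : Set (Rd d)} (hK : IsCompact K) (hne : K.Nonempty) :
    ∫⁻ f in hitting K, expSup f ∂(P.map fun ω => driftedPath hW.sigmaSq (W ω)) ≠ ∞ := by
  have hh : MeasurableSet (hitting K) := measurableSet_inter_argsup_nonempty hK.isClosed hne
  obtain ⟨g, hg, hgfin⟩ := hW.exists_lintegral_ne_top hK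
  rw [← lintegral_indicator hh, lintegral_map' (measurable_expSup.indicator hh).aemeasurable
    hW.aemeasurable_driftedPath]
  refine ne_top_of_le_ne_top hgfin (lintegral_mono fun ω => ?_)
  by_cases h : driftedPath hW.sigmaSq (W ω) ∈ hitting K
  · obtain ⟨t, ht, htK⟩ := h.2
    rw [Set.indicator_of_mem h, expSup, pathSup_eq_of_mem_argsup ht]
    refine le_trans (ENNReal.ofReal_le_ofReal (Real.exp_le_exp.2 ?_)) (hg ω t htK)
    have : 0 ≤ Var[fun ω => W ω t; P] := variance_nonneg _ _
    simp only [driftedPath, IsCentredGaussianField.sigmaSq, ContinuousMap.coe_mk]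
    linarith
  · rw [Set.indicator_of_notMem h]; exact zero_le

/-- The point `(T, x + M, F)` attached to `x` and the path `w`. -/
noncomputable def markMap (s : C(Rd d, ℝ)) (z : ℝ × C(Rd d, ℝ)) : Rd d × ℝ × C(Rd d, ℝ) :=
  (argsupInf' (driftedPath s z.2), z.1 + pathSup (driftedPath s z.2), recentred' (driftedPath s z.2))

theorem measurable_markMap (s : C(Rd d, ℝ)) : Measurable (markMap s) := by
  have h : Measurable fun z : ℝ × C(Rd d, ℝ) => driftedPath s z.2 :=
    (measurable_driftedPath s).comp measurable_snd
  exact (measurable_argsupInf'.comp h).prodMk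
    ((measurable_fst.add (measurable_pathSup.comp h)).prodMk (measurable_recentred'.comp h))

/-- For a fixed path, `y = x + M` turns `e^{-x} dx` into `e^M e^{-y} dy`. The height decouples and
the factor `e^M` is the weight in `markIntensity`. -/
theorem map_markMap_eq_prod {ν : Measure C(Rd d, ℝ)} [SFinite ν] (s : C(Rd d, ℝ)) {ρ : Measure (Rd d)}
    [SFinite ρ] {Q : Measure C(Rd d, ℝ)} [SFinite Q]
    (h : markIntensity (ν.map (driftedPath s)) = ρ.prod Q) :
    (expIntensity.prod ν).map (markMap s) = ρ.prod (expIntensity.prod Q) := by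
  refine Measure.ext_of_lintegral _ fun g hg => ?_
  have hgm : Measurable fun z : ℝ × C(Rd d, ℝ) => g (markMap s z) := hg.comp (measurable_markMap s)
  let G : Rd d × C(Rd d, ℝ) → ℝ≥0∞ := fun p => ∫⁻ y, g (p.1, y, p.2) ∂expIntensity
  have hgp : Measurable fun q : (Rd d × C(Rd d, ℝ)) × ℝ => g (q.1.1, q.2, q.1.2) :=
    hg.comp (by fun_prop)
  have hG : Measurable G := hgp.lintegral_prod_right'
  have hGm : Measurable fun f => expSup f * G (argsupInf' f, recentred' f) :=
    measurable_expSup.mul (hG.comp measurable_argsupInf'_recentred')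
  have hmd := measurable_driftedPath s
  calc ∫⁻ z, g z ∂(expIntensity.prod ν).map (markMap s)
      = ∫⁻ w, ∫⁻ x, g (markMap s (x, w)) ∂expIntensity ∂ν := by
        rw [lintegral_map hg (measurable_markMap s), lintegral_prod_symm _ hgm.aemeasurable]
    _ = ∫⁻ w, expSup (driftedPath s w)
          * G (argsupInf' (driftedPath s w), recentred' (driftedPath s w)) ∂ν := by
        refine lintegral_congr fun w => ?_
        exact lintegral_comp_add_expIntensity
          (g := fun y => g (argsupInf' (driftedPath s w), y, recentred' (driftedPath s w)))
          (hg.comp (by fun_prop)) (pathSup (driftedPath s w))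
    _ = ∫⁻ p, G p ∂ρ.prod Q := by
        rw [← h, lintegral_markIntensity hG, lintegral_map hGm hmd]
    _ = ∫⁻ z, g z ∂ρ.prod (expIntensity.prod Q) := by
        rw [lintegral_prod _ hG.aemeasurable, lintegral_prod _ hg.aemeasurable]
        refine lintegral_congr fun t => ?_
        have hgt : Measurable fun z : ℝ × C(Rd d, ℝ) => g (t, z) := hg.comp measurable_prodMk_left
        rw [lintegral_prod_symm _ hgt.aemeasurable]

end BrownResnick

theorem mainTheorem5 (d : ℕ)
    {Ω₀ : Type*} [MeasurableSpace Ω₀] (P₀ : Measure Ω₀) [IsProbabilityMeasure P₀]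
    (W : Ω₀ → C(Rd d, ℝ)) (hW : IsCentredGaussianField W P₀)
    (hlim : ∀ᵐ ω ∂P₀, Tendsto (fun t : Rd d => W ω t - Var[fun ω' => W ω' t; P₀] / 2)
      (cocompact (Rd d)) atBot) :
    ∃ (lam : ℝ≥0) (Q : Measure C(Rd d, ℝ)), 0 < lam ∧ IsProbabilityMeasure Q ∧
      ∀ (Ω : Type*) [MeasurableSpace Ω] (P : Measure Ω) [IsProbabilityMeasure P]
        (Wi : ℕ → Ω → C(Rd d, ℝ)) (X : ℕ → Ω → ℝ),
        iIndepFun Wi P →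
        (∀ i, IdentDistrib (Wi i) W P P₀) →
        (∀ i, AEMeasurable (X i) P) →
        IsPoissonPointProcess (pointSum X) expIntensity P →
        IndepFun (fun ω i => X i ω) (fun ω i => Wi i ω) P →
        let ξ : ℕ → Ω → C(Rd d, ℝ) := fun i ω => driftedPath hW.sigmaSq (Wi i ω)
        IsPoissonPointProcess
          (pointSum fun i ω => (argsupInf (ξ i ω), X i ω + pathSup (ξ i ω), recentred (ξ i ω)))
          ((lam • (volume : Measure (Rd d))).prod (expIntensity.prod Q)) P := by
  have hd := hW.aemeasurable_driftedPath
  have hmd := measurable_driftedPath hW.sigmaSq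
  have hprob := Measure.isProbabilityMeasure_map (μ := P₀) hd
  have hprob' := Measure.isProbabilityMeasure_map (μ := P₀) hW.aemeasurable
  have hmap : (P₀.map W).map (driftedPath hW.sigmaSq)
      = P₀.map fun ω => driftedPath hW.sigmaSq (W ω) :=
    AEMeasurable.map_map_of_aemeasurable hmd.aemeasurable hW.aemeasurable
  have hcoW : ∀ᵐ w ∂P₀.map W, driftedPath hW.sigmaSq w ∈ coercivePaths d :=
    (ae_map_iff hW.aemeasurable (hmd measurableSet_coercivePaths)).2 hlim
  have hco : ∀ᵐ f ∂P₀.map (fun ω => driftedPath hW.sigmaSq (W ω)), f ∈ coercivePaths d :=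
    (ae_map_iff hd measurableSet_coercivePaths).2 hlim
  obtain ⟨lam, Q, hlam, hQ, hκ⟩ := exists_markIntensity_eq_prod hco hW.tiltedIncrements_map_eq
    (hW.lintegral_hitting_expSup_ne_top isCompact_closedCube closedCube_nonempty)
  refine ⟨lam, Q, hlam, hQ, ?_⟩
  intro Ω _ P _ Wi X hWi hid hX hP hXW ξ
  have hρ := map_markMap_eq_prod (ν := P₀.map W) hW.sigmaSq (hmap ▸ hκ)
  refine hP.pointSum_marked hX (fun i => (hid i).aemeasurable_fst) hWi (fun i => (hid i).map_eq) hXW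
    (measurable_markMap hW.sigmaSq) (fun i => ?_) hρ
  have hcoi : ∀ᵐ ω ∂P, ξ i ω ∈ coercivePaths d := by
    have := hcoW
    rw [← (hid i).map_eq] at this
    exact ae_of_ae_map (hid i).aemeasurable_fst this
  filter_upwards [hcoi] with ω hω
  simp only [markMap]
  rw [argsupInf'_eq hω, recentred'_eq hω]
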